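/- Let $k\ge 1$ be a fixed integer. For $n\ge 1$ let $T_n$ be a uniform Cayley tree on $[n]=\{1,\dots,n\}$, i.e. a uniformly random element of the set of the $n^{n-1}$ rooted labelled trees on $[n]$, let $V_1,\dots,V_k$ be independent, uniformly random nodes in $[n]$, independent of $T_n$, and write $S_k=(V_1,\dots,V_k)$. Given a tree $t$ and a sequence $S=(v_1,\dots,v_k)$ of (not necessarily distinct) nodes of $t$, let $t\langle S\rangle$ be the tree obtained from $t$ by adding, for each $1\le i\le k$, a new node $w_i$ joined by an edge to $v_i$ only, and let $W=\{w_1,\dots,w_k\}$. The planted cutting of $S$ in $t$ is the following random procedure: $F^{(0)}=t\langle S\rangle$ and, for $j\ge 0$, $F^{(j+1)}$ is obtained from $F^{(j)}$ by removing an edge chosen uniformly at random among all the edges of those connected components of $F^{(j)}$ that contain at least one node of $W$, as long as there is such an edge; the procedure stops when these components are just the isolated nodes $w_1,\dots,w_k$. Let $M(t,S)$ be the total number of edges removed, and let $M(T_n,S_k)$ be the number of edges removed when, given $(T_n,S_k)$, the planted cutting of $S_k$ in $T_n$ is performed. Let $\chi_k$ be a chi random variable with $2k$ degrees of freedom, i.e.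 a nonnegative random variable with $$\mathbb P(\chi_k\le x)=\int_0^x \frac{2^{1-k}s^{2k-1}e^{-s^2/2}}{(k-1)!}\,ds\qquad (x\ge 0).$$ Then, as $n\to\infty$, $M(T_n,S_k)/\sqrt n$ converges to $\chi_k$ in distribution and in $L^p$ for every $p\in[1,\infty)$. Here convergence in $L^p$ means: there are a probability space and random variables $X_n$ ($n\ge1$) and $Y$ on it, the same for all $p$, such that $X_n$ has the law of $M(T_n,S_k)/\sqrt n$ for every $n$, $Y$ has the law of $\chi_k$, and for every $p\in[1,\infty)$ all these variables are in $L^p$ and $\mathbb E|X_n-Y|^p\to 0$. -/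

import Mathlib

open MeasureTheory ProbabilityTheory Filter Topology
open scoped ENNReal

noncomputable section

namespace CutTree

/-! ### Uniform Cayley trees -/

/-- Rooted labelled trees on `n` labelled nodes: a tree on the vertex set `Fin n`, with a root. -/
def RootedTree (n : ℕ) : Type :=
  {t : SimpleGraph (Fin n) × Fin n // t.1.IsTree}

instance (n : ℕ) : Finite (RootedTree n) :=
  inferInstanceAs (Finite {t : SimpleGraph (Fin n) × Fin n // t.1.IsTree})

instance (n : ℕ) : Fintype (RootedTree n) := Fintype.ofFinite _

instance (n : ℕ) [NeZero n] : Nonempty (RootedTree n) :=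
  ⟨⟨(SimpleGraph.starGraph 0, 0), SimpleGraph.isTree_starGraph 0⟩⟩

/-! ### Planted cutting -/

/-- The planting of the tree `t` at the sequence `S = (v₁, …, v_k)` of not necessarily distinct
nodes: the nodes of `t` are the `Sum.inl v`, the new nodes are `w_i = Sum.inr i`, and the only
neighbour of `w_i` is `v_i`. -/
def planting {n k : ℕ} (t : SimpleGraph (Fin n)) (S : Fin k → Fin n) :
    SimpleGraph (Fin n ⊕ Fin k) :=
  t.map Function.Embedding.inl ⊔
    SimpleGraph.fromEdgeSet (Set.range fun i => s(Sum.inl (S i), Sum.inr i))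

/-- The edges of `C(W, F)`: the edges of `F` that lie in the connected component of some new node
`w_i`. -/
def activeEdges {n k : ℕ} (F : SimpleGraph (Fin n ⊕ Fin k)) : Set (Sym2 (Fin n ⊕ Fin k)) :=
  {e | e ∈ F.edgeSet ∧ ∃ i : Fin k, ∀ v ∈ e, F.Reachable (Sum.inr i) v}

/-- `activeEdges` as a finset. -/
def activeFinset {n k : ℕ} (F : SimpleGraph (Fin n ⊕ Fin k)) : Finset (Sym2 (Fin n ⊕ Fin k)) :=
  (Set.toFinite (activeEdges F)).toFinset

lemma mem_activeFinset {n k : ℕ} {F : SimpleGraph (Fin n ⊕ Fin k)}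
    {e : Sym2 (Fin n ⊕ Fin k)} : e ∈ activeFinset F ↔ e ∈ activeEdges F := by
  simp [activeFinset]

lemma ncard_edgeSet_deleteEdges_lt {n k : ℕ} {F : SimpleGraph (Fin n ⊕ Fin k)}
    {e : Sym2 (Fin n ⊕ Fin k)} (he : e ∈ activeEdges F) :
    (F.deleteEdges {e}).edgeSet.ncard < F.edgeSet.ncard := by
  rw [SimpleGraph.edgeSet_deleteEdges]
  exact Set.ncard_sdiff_singleton_lt_of_mem he.1 (Set.toFinite _)

open Classical in
/-- The law of the sequence of edges removed by the cutting procedure started from the graph `F`: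
as long as `C(W, F)` has an edge, remove one of its edges, chosen uniformly at random; stop when
there is none left, that is, when `C(W, F)` consists of the isolated nodes `w₁, …, w_k` only. -/
def cutSequence {n k : ℕ} (F : SimpleGraph (Fin n ⊕ Fin k)) :
    PMF (List (Sym2 (Fin n ⊕ Fin k))) :=
  if h : (activeFinset F).Nonempty then
    (PMF.uniformOfFinset (activeFinset F) h).bindOnSupport fun e _ =>
      (cutSequence (F.deleteEdges {e})).map (e :: ·)
  else PMF.pure []
termination_by F.edgeSet.ncard
decreasing_by
  rename_i he
  exact ncard_edgeSet_deleteEdges_lt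
    (mem_activeFinset.1 ((PMF.mem_support_uniformOfFinset_iff h e).1 he))

/-- An outcome of the random experiment: a rooted tree on `n` nodes, a sequence of `k` of its nodes,
and the sequence of edges removed by the planted cutting. -/
structure Outcome (n k : ℕ) where
  /-- the tree `T_n` -/
  tree : RootedTree n
  /-- the sequence `S_k = (V₁, …, V_k)` -/
  nodes : Fin k → Fin n
  /-- the removed edges, in the order of removal -/
  cuts : List (Sym2 (Fin n ⊕ Fin k))

instance (n k : ℕ) : MeasurableSpace (Outcome n k) := ⊤

/-- The number `M(T_n, S_k)` of edges removed by the planted cutting. -/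
def Outcome.cutCount {n k : ℕ} (o : Outcome n k) : ℕ := o.cuts.length

/-- The joint law of `T_n`, `S_k` and the sequence of edges removed: `T_n` is a uniform Cayley tree;
`V₁, …, V_k` are independent uniform nodes, independent of `T_n` (so that `S_k` is uniform on the
`n ^ k` sequences); given these, the edges are removed by the planted cutting of `S_k` in `T_n`. -/
def plantedCutting (n k : ℕ) [NeZero n] : PMF (Outcome n k) :=
  (PMF.uniformOfFintype (RootedTree n)).bind fun t =>
    (PMF.uniformOfFintype (Fin k → Fin n)).bind fun S =>
      (cutSequence (planting t.1.1 S)).map fun e => ⟨t, S, e⟩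

/-- The random variable `M(T_n, S_k) / √n`. -/
def normalizedCuts (n k : ℕ) (o : Outcome n k) : ℝ := (o.cutCount : ℝ) / √(n : ℝ)

/-! ### The chi distribution with an even number of degrees of freedom -/

/-- The density of the chi distribution with `2 k` degrees of freedom (for `k ≥ 1`). -/
def chiPDF (k : ℕ) (s : ℝ) : ℝ :=
  if 0 ≤ s then
    (2 : ℝ) ^ (1 - (k : ℤ)) * s ^ (2 * k - 1) * Real.exp (-s ^ 2 / 2) / ((k - 1).factorial : ℝ)
  else 0

/-- The chi distribution with `2 k` degrees of freedom (for `k ≥ 1`). -/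
def chiMeasure (k : ℕ) : Measure ℝ :=
  volume.withDensity fun s => ENNReal.ofReal (chiPDF k s)

instance isProbabilityMeasure_chiMeasure (k : ℕ) [NeZero k] :
    IsProbabilityMeasure (chiMeasure k) := by
  obtain ⟨m, rfl⟩ : ∃ m, k = m + 1 := Nat.exists_eq_succ_of_ne_zero (NeZero.ne k)
  have hm0 : (0 : ℝ) ≤ m := Nat.cast_nonneg m
  set c : ℝ := (2 : ℝ) ^ (1 - ((m + 1 : ℕ) : ℤ)) / (m.factorial : ℝ) with hc
  have hc0 : 0 ≤ c := by positivity
  set g : ℝ → ℝ := fun s => s ^ (2 * (m : ℝ) + 1) * Real.exp (-(1 / 2) * s ^ (2 : ℝ)) with hg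
  have hpdf : ∀ s ∈ Set.Ioi (0 : ℝ), chiPDF (m + 1) s = c * g s := by
    intro s hs
    have h0 : (0 : ℝ) ≤ s := le_of_lt hs
    have e1 : s ^ (2 * (m : ℝ) + 1) = s ^ (2 * m + 1) := by
      rw [← Real.rpow_natCast]; push_cast; rfl
    have e2 : s ^ (2 : ℝ) = s ^ 2 := by
      rw [← Real.rpow_natCast]; norm_num
    simp only [chiPDF, if_pos h0, hg, e1, e2, hc, Nat.add_sub_cancel]
    rw [show 2 * (m + 1) - 1 = 2 * m + 1 by omega,
      show -s ^ 2 / 2 = -(1 / 2) * s ^ 2 by ring]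
    ring
  have hint : IntegrableOn g (Set.Ioi 0) :=
    integrableOn_rpow_mul_exp_neg_mul_rpow (by linarith) (by norm_num) (by norm_num)
  have hval : ∫ s in Set.Ioi (0 : ℝ), c * g s = 1 := by
    rw [integral_const_mul, hg, integral_rpow_mul_exp_neg_mul_rpow (by norm_num) (by linarith)
      (by norm_num), show (2 * (m : ℝ) + 1 + 1) / 2 = (m : ℝ) + 1 by ring,
      Real.Gamma_nat_eq_factorial, hc,
      show -((2 * (m : ℝ) + 1) + 1) / 2 = -(m : ℝ) + -1 by ring, Real.rpow_add (by norm_num)]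
    have hf : (m.factorial : ℝ) ≠ 0 := by positivity
    have h1 : ((1 / 2 : ℝ)) ^ (-(m : ℝ)) = 2 ^ m := by
      rw [one_div, Real.inv_rpow (by norm_num), Real.rpow_neg (by norm_num), inv_inv,
        Real.rpow_natCast]
    have h2 : ((1 / 2 : ℝ)) ^ (-(1 : ℝ)) = 2 := by
      rw [Real.rpow_neg (by norm_num), Real.rpow_one]; norm_num
    have h3 : (2 : ℝ) ^ (1 - ((m + 1 : ℕ) : ℤ)) = (2 ^ m)⁻¹ := by
      rw [show 1 - ((m + 1 : ℕ) : ℤ) = -(m : ℤ) by push_cast; ring, zpow_neg, zpow_natCast]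
    rw [h1, h2, h3]
    field_simp
  constructor
  rw [chiMeasure, withDensity_apply _ MeasurableSet.univ, Measure.restrict_univ,
    ← lintegral_add_compl _ (measurableSet_Ioi (a := (0 : ℝ)))]
  have hcompl : ∫⁻ s in (Set.Ioi (0 : ℝ))ᶜ, ENNReal.ofReal (chiPDF (m + 1) s) = 0 := by
    rw [setLIntegral_congr_fun (g := fun _ => 0) measurableSet_Ioi.compl, lintegral_zero]
    intro s hs
    have hs' : s ≤ 0 := by simpa using hs
    rcases hs'.lt_or_eq with h | h
    · simp [chiPDF, not_le.2 h]
    · have h2 : 2 * (m + 1) - 1 ≠ 0 := by omega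
      simp [chiPDF, h, zero_pow h2]
  rw [hcompl, add_zero, setLIntegral_congr_fun measurableSet_Ioi
    (fun s hs => by rw [hpdf s hs] : Set.EqOn _ (fun s => ENNReal.ofReal (c * g s)) _),
    ← ofReal_integral_eq_lintegral_ofReal (hint.const_mul c), hval, ENNReal.ofReal_one]
  filter_upwards [ae_restrict_mem measurableSet_Ioi] with s hs
  have hs' : (0 : ℝ) < s := hs
  simp only [hg]
  positivity

end CutTree

end

/-!
# The number of cuts in planted cuttings of uniform Cayley trees

The proof compares the cutting with the sampling of uniform values in `{1, …, n}`: if `d` values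
have been seen, the next sample is a repeat with probability `d / n` and a new value otherwise. The
number of samples needed after the first one to see `k` repeats, divided by `√n`, tends to `χ_k`,
because the repeats form in the limit a Poisson process of intensity `y dy`.

*Locality.* The law of the number of cuts is unchanged if the first edge to be removed is chosen
uniformly within some of the active components only (`IsActiveUnion.card_mul_meanCut`). So the cuts
may be made in the component of one chosen new node `w_j` until `w_j` is isolated.

*Uniform rooted forests.* Consider a uniform rooted forest on `Fin n` with `d` trees and nodes
planted at independent uniform places. If the component of `w_j` has `a` nodes in the forest, it has
`a - 1` forest edges and the planted edge at `w_j`; suppose one of these `a` edges is removed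
uniformly. A forest with `d + 1` trees arises from one with `d` trees by removing an edge
of the tree of a root `v` in as many ways as one of the other `d` trees can be hung from a node of
the tree of `v` (`sum_rootedForests_deleteEdges`). Hence the new forest is again uniform: with
probability `d / n` the cut isolates `w_j`, and with probability `1 - d / n` it leaves a uniform
rooted forest with `d + 1` trees. This is the chain of repeats, started from `d = 1`.

*The other planted edges.* The component of `w_j` may also contain the planted edges of other nodes
`w_i`, which changes the recursion. A given `S i` falls in a tree of size `a` with probability
`a / n`, and the correction has weight `1 / a`, so each step has an error of order `1 / n`
(`totalMean_eq`, `abs_cutError_le`). Only about `√n` steps matter, so the error vanishes in the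
limit (`abs_totalMean_tailIndicator_sub_le`). Poisson probabilities solve the recursion up to an
error of the same order, and the tail of `M(T_n, S_k) / √n` converges to the tail
`P(Poisson(y² / 2) < k)` of `χ_k` (`tendsto_cutTail`, `chiMeasure_Ioi`).

*Convergence in `L^p`.* For nonnegative functionals the correction is bounded by terms with one new
node less, and a supersolution of the resulting recursion bounds an exponential moment of
`M(T_n, S_k) / √n` uniformly in `n` (`totalMean_exp_le`). The quantile transform realizes all the
laws as functions of one chi variable `ω`; these converge pointwise to `ω`, and by the
exponential tail they are dominated by `C + ω²`, so that dominated convergence applies.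
-/

namespace CutTree

/-! ### The mean of a function of the number of cuts -/

section MeanCut

variable {n k : ℕ}

open Classical in
/-- The expectation of `φ M`, where `M` is the number of edges removed by the cutting procedure
started from the graph `F`. -/
noncomputable def meanCut (φ : ℕ → ℝ) (F : SimpleGraph (Fin n ⊕ Fin k)) : ℝ :=
  if (activeFinset F).Nonempty then
    (∑ e ∈ (activeFinset F).attach, meanCut (fun m => φ (m + 1)) (F.deleteEdges {e.1})) /
      (activeFinset F).card
  else φ 0
termination_by F.edgeSet.ncard
decreasing_by exact ncard_edgeSet_deleteEdges_lt (mem_activeFinset.1 e.2)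

lemma meanCut_of_activeFinset_eq_empty {φ : ℕ → ℝ} {F : SimpleGraph (Fin n ⊕ Fin k)}
    (h : activeFinset F = ∅) : meanCut φ F = φ 0 := by
  rw [meanCut, if_neg (by simp [h])]

lemma card_mul_meanCut (φ : ℕ → ℝ) (F : SimpleGraph (Fin n ⊕ Fin k)) :
    ((activeFinset F).card : ℝ) * meanCut φ F =
      ∑ e ∈ activeFinset F, meanCut (fun m => φ (m + 1)) (F.deleteEdges {e}) := by
  by_cases h : (activeFinset F).Nonempty
  · rw [meanCut, if_pos h, Finset.sum_attach (activeFinset F)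
      (fun e => meanCut (fun m => φ (m + 1)) (F.deleteEdges {e}))]
    have : ((activeFinset F).card : ℝ) ≠ 0 := by simpa using h.ne_empty
    field_simp
  · simp [Finset.not_nonempty_iff_eq_empty.1 h]

/-- Induction along the cutting procedure. -/
lemma cut_induction {motive : SimpleGraph (Fin n ⊕ Fin k) → Prop}
    (step : ∀ F, (∀ e ∈ F.edgeSet, motive (F.deleteEdges {e})) → motive F)
    (F : SimpleGraph (Fin n ⊕ Fin k)) : motive F := by
  induction hN : F.edgeSet.ncard using Nat.strong_induction_on generalizing F with
  | _ N ih =>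
    refine step F fun e he => ih _ ?_ _ rfl
    rw [← hN, SimpleGraph.edgeSet_deleteEdges]
    exact Set.ncard_sdiff_singleton_lt_of_mem he (Set.toFinite _)

lemma mem_edgeSet_of_mem_activeFinset {F : SimpleGraph (Fin n ⊕ Fin k)}
    {e : Sym2 (Fin n ⊕ Fin k)} (he : e ∈ activeFinset F) : e ∈ F.edgeSet :=
  (mem_activeFinset.1 he).1

lemma meanCut_const (c : ℝ) (F : SimpleGraph (Fin n ⊕ Fin k)) :
    meanCut (fun _ => c) F = c := by
  induction F using cut_induction with
  | step F ih =>
    rcases (activeFinset F).eq_empty_or_nonempty with h | h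
    · rw [meanCut_of_activeFinset_eq_empty h]
    · have hc : ((activeFinset F).card : ℝ) ≠ 0 := by simpa using h.ne_empty
      apply mul_left_cancel₀ hc
      rw [card_mul_meanCut, Finset.sum_congr rfl fun e he =>
        ih e (mem_edgeSet_of_mem_activeFinset he)]
      simp

lemma meanCut_const_mul (c : ℝ) (φ : ℕ → ℝ) (F : SimpleGraph (Fin n ⊕ Fin k)) :
    meanCut (fun m => c * φ m) F = c * meanCut φ F := by
  induction F using cut_induction generalizing φ with
  | step F ih =>
    rcases (activeFinset F).eq_empty_or_nonempty with h | h
    · rw [meanCut_of_activeFinset_eq_empty h, meanCut_of_activeFinset_eq_empty h]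
    · have hc : ((activeFinset F).card : ℝ) ≠ 0 := by simpa using h.ne_empty
      apply mul_left_cancel₀ hc
      rw [card_mul_meanCut, mul_left_comm, card_mul_meanCut, Finset.mul_sum]
      exact Finset.sum_congr rfl fun e he =>
        ih e (mem_edgeSet_of_mem_activeFinset he) fun m => φ (m + 1)

lemma meanCut_mono {φ ψ : ℕ → ℝ} (hφ : ∀ m, φ m ≤ ψ m) (F : SimpleGraph (Fin n ⊕ Fin k)) :
    meanCut φ F ≤ meanCut ψ F := by
  induction F using cut_induction generalizing φ ψ with
  | step F ih =>
    rcases (activeFinset F).eq_empty_or_nonempty with h | h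
    · rw [meanCut_of_activeFinset_eq_empty h, meanCut_of_activeFinset_eq_empty h]
      exact hφ 0
    · have hc : (0 : ℝ) < (activeFinset F).card := by simpa using h
      refine le_of_mul_le_mul_left ?_ hc
      rw [card_mul_meanCut, card_mul_meanCut]
      exact Finset.sum_le_sum fun e he =>
        ih e (mem_edgeSet_of_mem_activeFinset he) fun m => hφ (m + 1)

lemma meanCut_nonneg {φ : ℕ → ℝ} (hφ : ∀ m, 0 ≤ φ m) (F : SimpleGraph (Fin n ⊕ Fin k)) :
    0 ≤ meanCut φ F := by
  rw [← meanCut_const 0 F]; exact meanCut_mono hφ F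

/-- The expectation of `φ M` as a sum over the outcomes of the cutting procedure. -/
lemma tsum_cutSequence (φ : ℕ → ℝ) (hφ : ∀ m, 0 ≤ φ m) (F : SimpleGraph (Fin n ⊕ Fin k)) :
    ∑' l, cutSequence F l * ENNReal.ofReal (φ l.length) = ENNReal.ofReal (meanCut φ F) := by
  classical
  induction F using cut_induction generalizing φ with
  | step F ih =>
    rcases (activeFinset F).eq_empty_or_nonempty with h | h
    · rw [meanCut_of_activeFinset_eq_empty h, cutSequence, dif_neg (by simp [h])]
      rw [tsum_eq_single []]
      · simp
      · intro l hl
        simp [hl]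
    · have hc : (0 : ℝ) < (activeFinset F).card := by simpa using h
      have hm : meanCut φ F = (∑ e ∈ activeFinset F,
          meanCut (fun m => φ (m + 1)) (F.deleteEdges {e})) / (activeFinset F).card := by
        rw [← card_mul_meanCut]; field_simp
      rw [hm, cutSequence, dif_pos h, ENNReal.ofReal_div_of_pos hc,
        ENNReal.ofReal_sum_of_nonneg fun e _ => meanCut_nonneg (fun m => hφ _) _]
      have hsum : ∀ e ∈ activeFinset F,
          ∑' l, (PMF.map (e :: ·) (cutSequence (F.deleteEdges {e}))) l *
            ENNReal.ofReal (φ l.length) =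
          ENNReal.ofReal (meanCut (fun m => φ (m + 1)) (F.deleteEdges {e})) := by
        intro e he
        rw [← ih e (mem_edgeSet_of_mem_activeFinset he) (fun m => φ (m + 1)) (fun m => hφ _)]
        simp only [PMF.map_apply, ← ENNReal.tsum_mul_right]
        rw [ENNReal.tsum_comm]
        refine tsum_congr fun l => ?_
        rw [tsum_eq_single (e :: l)]
        · simp
        · intro l' hl'
          simp [hl']
      simp only [PMF.bindOnSupport_apply, ← ENNReal.tsum_mul_right]
      rw [ENNReal.tsum_comm, tsum_eq_sum (s := activeFinset F)]
      · rw [ENNReal.div_eq_inv_mul, Finset.mul_sum]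
        refine Finset.sum_congr rfl fun e he => ?_
        rw [← hsum e he, ← ENNReal.tsum_mul_left]
        refine tsum_congr fun l => ?_
        rw [PMF.uniformOfFinset_apply_of_mem _ he, dif_neg (by simp), mul_assoc,
          ENNReal.ofReal_natCast]
      · intro e he
        simp [PMF.uniformOfFinset_apply_of_notMem _ he]

/-! ### Looking only at the cuts in some components -/

open Classical in
/-- The edges of `F` with both ends in `X`. -/
noncomputable def edgesWithin {V : Type*} [Finite V] (F : SimpleGraph V) (X : Set V) :
    Finset (Sym2 V) :=
  (Set.toFinite {e | e ∈ F.edgeSet ∧ ∀ v ∈ e, v ∈ X}).toFinset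

lemma mem_edgesWithin {V : Type*} [Finite V] {F : SimpleGraph V} {X : Set V} {e : Sym2 V} :
    e ∈ edgesWithin F X ↔ e ∈ F.edgeSet ∧ ∀ v ∈ e, v ∈ X := by
  simp [edgesWithin]

/-- `X` is a union of connected components of `F`, each of which contains a new node. -/
structure IsActiveUnion (F : SimpleGraph (Fin n ⊕ Fin k)) (X : Set (Fin n ⊕ Fin k)) : Prop where
  closed : ∀ u v, F.Adj u v → u ∈ X → v ∈ X
  reach : ∀ v ∈ X, ∃ i : Fin k, F.Reachable (Sum.inr i) v

lemma edgesWithin_deleteEdges {V : Type*} [Finite V] [DecidableEq V]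
    (F : SimpleGraph V) (X : Set V) (e : Sym2 V) :
    edgesWithin (F.deleteEdges {e}) X = (edgesWithin F X).erase e := by
  ext f
  simp only [mem_edgesWithin, SimpleGraph.edgeSet_deleteEdges, Finset.mem_erase, Set.mem_sdiff,
    Set.mem_singleton_iff]
  tauto

/-- Membership in a union of components is unchanged along walks. -/
lemma mem_of_reachable_of_closed {V : Type*} {F : SimpleGraph V} {X : Set V}
    (h : ∀ u v, F.Adj u v → u ∈ X → v ∈ X) {u v : V} (huv : F.Reachable u v) (hu : u ∈ X) :
    v ∈ X := by
  obtain ⟨w⟩ := huv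
  induction w with
  | nil => exact hu
  | cons hadj _ ih => exact ih (h _ _ hadj hu)

lemma reachable_deleteEdges_of_closed {V : Type*} {F : SimpleGraph V} {X : Set V}
    (h : ∀ u v, F.Adj u v → u ∈ X → v ∈ X) {e : Sym2 V} (he : ∃ v ∈ e, v ∉ X) {u v : V}
    (huv : F.Reachable u v) (hu : u ∈ X) : (F.deleteEdges {e}).Reachable u v := by
  obtain ⟨w⟩ := huv
  induction w with
  | nil => rfl
  | @cons a b c hadj w ih =>
    have hb := h _ _ hadj hu
    refine SimpleGraph.Reachable.trans (SimpleGraph.Adj.reachable ?_) (ih hb)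
    rw [SimpleGraph.deleteEdges_adj]
    refine ⟨hadj, ?_⟩
    rintro rfl
    obtain ⟨x, hx, hxX⟩ := he
    rcases Sym2.mem_iff.1 hx with rfl | rfl
    · exact hxX hu
    · exact hxX hb

lemma IsActiveUnion.deleteEdges {F : SimpleGraph (Fin n ⊕ Fin k)} {X : Set (Fin n ⊕ Fin k)}
    (hX : IsActiveUnion F X) {e : Sym2 (Fin n ⊕ Fin k)} (he : ∃ v ∈ e, v ∉ X) :
    IsActiveUnion (F.deleteEdges {e}) X where
  closed u v huv hu := hX.closed u v (SimpleGraph.deleteEdges_le _ huv) hu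
  reach v hv := by
    obtain ⟨i, hi⟩ := hX.reach v hv
    exact ⟨i, (reachable_deleteEdges_of_closed hX.closed he hi.symm hv).symm⟩

lemma IsActiveUnion.edgesWithin_subset {F : SimpleGraph (Fin n ⊕ Fin k)}
    {X : Set (Fin n ⊕ Fin k)} (hX : IsActiveUnion F X) : edgesWithin F X ⊆ activeFinset F := by
  intro e he
  rw [mem_edgesWithin] at he
  rw [mem_activeFinset]
  refine ⟨he.1, ?_⟩
  induction e with
  | _ x y =>
    obtain ⟨i, hi⟩ := hX.reach x (he.2 x (by simp))
    refine ⟨i, fun v hv => ?_⟩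
    rcases Sym2.mem_iff.1 hv with rfl | rfl
    · exact hi
    · exact hi.trans (SimpleGraph.Adj.reachable (by simpa using he.1))

/-- The active edges outside an active union form the edges of another active union. -/
lemma IsActiveUnion.compl {F : SimpleGraph (Fin n ⊕ Fin k)} {X : Set (Fin n ⊕ Fin k)}
    (hX : IsActiveUnion F X) :
    ∃ Y, IsActiveUnion F Y ∧ Disjoint X Y ∧
      ∀ e, e ∈ activeFinset F ↔ e ∈ edgesWithin F X ∨ e ∈ edgesWithin F Y := by
  set Y : Set (Fin n ⊕ Fin k) := {v | v ∉ X ∧ ∃ i : Fin k, F.Reachable (Sum.inr i) v} with hY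
  have hYu : IsActiveUnion F Y := by
    refine ⟨?_, fun v hv => hv.2⟩
    rintro u v huv ⟨hu, i, hi⟩
    exact ⟨fun hv => hu (hX.closed v u huv.symm hv), i, hi.trans huv.reachable⟩
  refine ⟨Y, hYu, Set.disjoint_left.2 fun v hv hv' => hv'.1 hv, fun e => ⟨fun he => ?_, ?_⟩⟩
  · rw [mem_activeFinset] at he
    obtain ⟨hF, i, hi⟩ := he
    simp only [mem_edgesWithin]
    induction e with
    | _ x y =>
      have hxy : F.Adj x y := by simpa using hF
      have hx := hi x (by simp)
      have hy := hi y (by simp)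
      by_cases hxX : x ∈ X
      · left
        refine ⟨hF, fun v hv => ?_⟩
        rcases Sym2.mem_iff.1 hv with rfl | rfl
        · exact hxX
        · exact hX.closed _ _ hxy hxX
      · right
        refine ⟨hF, fun v hv => ?_⟩
        rcases Sym2.mem_iff.1 hv with rfl | rfl
        · exact ⟨hxX, i, hi _ (by simp)⟩
        · exact ⟨fun h => hxX (hX.closed _ _ hxy.symm h), i, hy⟩
  · rintro (he | he)
    · exact hX.edgesWithin_subset he
    · exact hYu.edgesWithin_subset he

/-- **Locality of the cutting procedure.** The law of the total number of cuts does not change if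
the first edge to be removed is chosen uniformly among the edges of some of the active components
only: the order of the cuts made in different components does not matter. -/
theorem IsActiveUnion.card_mul_meanCut {F : SimpleGraph (Fin n ⊕ Fin k)}
    {X : Set (Fin n ⊕ Fin k)} (hX : IsActiveUnion F X) (φ : ℕ → ℝ) :
    ((edgesWithin F X).card : ℝ) * meanCut φ F =
      ∑ e ∈ edgesWithin F X, meanCut (fun m => φ (m + 1)) (F.deleteEdges {e}) := by
  classical
  induction F using cut_induction generalizing φ X with
  | step F ih =>
    obtain ⟨Y, hY, hXY, hact⟩ := hX.compl
    set D := edgesWithin F X with hD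
    set D' := edgesWithin F Y with hD'
    have hfst : ∀ e ∈ D, ∃ v ∈ e, v ∉ Y := by
      intro e he
      rw [hD, mem_edgesWithin] at he
      exact ⟨_, Sym2.out_fst_mem e, Set.disjoint_left.1 hXY (he.2 _ (Sym2.out_fst_mem e))⟩
    have hfst' : ∀ e ∈ D', ∃ v ∈ e, v ∉ X := by
      intro e he
      rw [hD', mem_edgesWithin] at he
      exact ⟨_, Sym2.out_fst_mem e, Set.disjoint_right.1 hXY (he.2 _ (Sym2.out_fst_mem e))⟩
    have hdisj : Disjoint D D' := by
      rw [Finset.disjoint_left]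
      intro e he he'
      obtain ⟨v, hv, hvY⟩ := hfst e he
      exact hvY ((mem_edgesWithin.1 he').2 v hv)
    have hC : activeFinset F = D ∪ D' := by
      ext e; rw [hact, Finset.mem_union]
    rcases D.eq_empty_or_nonempty with hDe | hDn
    · simp [hDe]
    have hDF : ∀ e ∈ D, e ∈ F.edgeSet := fun e he => (mem_edgesWithin.1 he).1
    have hDF' : ∀ e ∈ D', e ∈ F.edgeSet := fun e he => (mem_edgesWithin.1 he).1
    have main := CutTree.card_mul_meanCut φ F
    rw [hC, Finset.card_union_of_disjoint hdisj, Finset.sum_union hdisj] at main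
    -- remove an edge `f` of `Y` first and then one of `X`, or the other way round
    have h1 : ∀ f ∈ D', (D.card : ℝ) * meanCut (fun m => φ (m + 1)) (F.deleteEdges {f}) =
        ∑ e ∈ D, meanCut (fun m => φ (m + 1 + 1)) ((F.deleteEdges {f}).deleteEdges {e}) := by
      intro f hf
      have := ih f (hDF' f hf) (hX.deleteEdges (hfst' f hf)) (fun m => φ (m + 1))
      rwa [edgesWithin_deleteEdges, ← hD,
        Finset.erase_eq_of_notMem (Finset.disjoint_right.1 hdisj hf)] at this
    have h2 : ∀ e ∈ D, (D'.card : ℝ) * meanCut (fun m => φ (m + 1)) (F.deleteEdges {e}) =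
        ∑ f ∈ D', meanCut (fun m => φ (m + 1 + 1)) ((F.deleteEdges {e}).deleteEdges {f}) := by
      intro e he
      have := ih e (hDF e he) (hY.deleteEdges (hfst e he)) (fun m => φ (m + 1))
      rwa [edgesWithin_deleteEdges, ← hD',
        Finset.erase_eq_of_notMem (Finset.disjoint_left.1 hdisj he)] at this
    have h3 : (D.card : ℝ) * ∑ f ∈ D', meanCut (fun m => φ (m + 1)) (F.deleteEdges {f}) =
        (D'.card : ℝ) * ∑ e ∈ D, meanCut (fun m => φ (m + 1)) (F.deleteEdges {e}) := by
      rw [Finset.mul_sum, Finset.mul_sum, Finset.sum_congr rfl h1, Finset.sum_congr rfl h2,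
        Finset.sum_comm]
      refine Finset.sum_congr rfl fun e _ => Finset.sum_congr rfl fun f _ => ?_
      rw [SimpleGraph.deleteEdges_deleteEdges, SimpleGraph.deleteEdges_deleteEdges, Set.union_comm]
    have hpos : (0 : ℝ) < D.card + D'.card := by
      have : (0 : ℝ) < D.card := by simpa using hDn
      positivity
    apply mul_left_cancel₀ hpos.ne'
    push_cast at main
    linear_combination (D.card : ℝ) * main + h3

end MeanCut

/-! ### Planted forests -/

section Planted

variable {n k : ℕ}

/-- The graph `F` with a new node `w_i` planted at `S i`, for the indices `i ∈ J` only; the other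
new nodes are isolated. -/
def plantedAt (F : SimpleGraph (Fin n)) (S : Fin k → Fin n) (J : Finset (Fin k)) :
    SimpleGraph (Fin n ⊕ Fin k) where
  Adj
    | Sum.inl u, Sum.inl v => F.Adj u v
    | Sum.inl u, Sum.inr i => i ∈ J ∧ S i = u
    | Sum.inr i, Sum.inl u => i ∈ J ∧ S i = u
    | Sum.inr _, Sum.inr _ => False
  symm := ⟨by
    rintro (u | i) (v | j) h
    · exact h.symm
    · exact h
    · exact h
    · exact h⟩
  loopless := ⟨by
    rintro (u | i) h
    · exact F.loopless.irrefl u h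
    · exact h⟩

variable {F : SimpleGraph (Fin n)} {S : Fin k → Fin n} {J : Finset (Fin k)}

@[simp] lemma plantedAt_adj_inl_inl {u v : Fin n} :
    (plantedAt F S J).Adj (Sum.inl u) (Sum.inl v) ↔ F.Adj u v := Iff.rfl

@[simp] lemma plantedAt_adj_inl_inr {u : Fin n} {i : Fin k} :
    (plantedAt F S J).Adj (Sum.inl u) (Sum.inr i) ↔ i ∈ J ∧ S i = u := Iff.rfl

@[simp] lemma plantedAt_adj_inr_inl {u : Fin n} {i : Fin k} :
    (plantedAt F S J).Adj (Sum.inr i) (Sum.inl u) ↔ i ∈ J ∧ S i = u := Iff.rfl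

@[simp] lemma plantedAt_adj_inr_inr {i j : Fin k} :
    ¬ (plantedAt F S J).Adj (Sum.inr i) (Sum.inr j) := fun h => h

lemma plantedAt_univ (t : SimpleGraph (Fin n)) (S : Fin k → Fin n) :
    plantedAt t S Finset.univ = planting t S := by
  ext (u | i) (v | j) <;> simp [planting, eq_comm]

lemma plantedAt_deleteEdges_inl (x y : Fin n) :
    (plantedAt F S J).deleteEdges {s(Sum.inl x, Sum.inl y)} =
      plantedAt (F.deleteEdges {s(x, y)}) S J := by
  ext (u | i) (v | j) <;> simp [SimpleGraph.deleteEdges_adj]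

lemma plantedAt_deleteEdges_inr (i : Fin k) :
    (plantedAt F S J).deleteEdges {s(Sum.inl (S i), Sum.inr i)} =
      plantedAt F S (J.erase i) := by
  ext (u | a) (v | b)
  · simp [SimpleGraph.deleteEdges_adj]
  · simp only [SimpleGraph.deleteEdges_adj, plantedAt_adj_inl_inr, Finset.mem_erase]
    simp
    grind
  · simp only [SimpleGraph.deleteEdges_adj, plantedAt_adj_inr_inl, Finset.mem_erase]
    simp
    grind
  · simp [SimpleGraph.deleteEdges_adj]

lemma plantedAt_congr {S S' : Fin k → Fin n} (h : ∀ i ∈ J, S i = S' i) :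
    plantedAt F S J = plantedAt F S' J := by
  ext (u | i) (v | j)
  · simp
  · simp only [plantedAt_adj_inl_inr]
    exact and_congr_right fun hj => by rw [h j hj]
  · simp only [plantedAt_adj_inr_inl]
    exact and_congr_right fun hj => by rw [h i hj]
  · simp

lemma activeFinset_plantedAt_empty : activeFinset (plantedAt F S (∅ : Finset (Fin k))) = ∅ := by
  rw [Finset.eq_empty_iff_forall_notMem]
  intro e he
  rw [mem_activeFinset] at he
  obtain ⟨hF, i, hi⟩ := he
  have hiso : ∀ v, (plantedAt F S (∅ : Finset (Fin k))).Reachable (Sum.inr i) v → v = Sum.inr i := by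
    intro v hv
    refine mem_of_reachable_of_closed (X := {v | v = Sum.inr i}) ?_ hv rfl
    rintro u v huv rfl
    rcases v with v | j <;> simp at huv
  induction e with
  | _ x y =>
    have hx := hiso x (hi x (by simp))
    have hy := hiso y (hi y (by simp))
    subst hx hy
    simp at hF

lemma meanCut_plantedAt_empty (φ : ℕ → ℝ) : meanCut φ (plantedAt F S (∅ : Finset (Fin k))) = φ 0 :=
  meanCut_of_activeFinset_eq_empty activeFinset_plantedAt_empty

open Classical in
/-- The connected component of `v` in `F`, as a finset. -/
noncomputable def comp (F : SimpleGraph (Fin n)) (v : Fin n) : Finset (Fin n) :=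
  Finset.univ.filter fun u => F.Reachable v u

lemma mem_comp {u v : Fin n} : u ∈ comp F v ↔ F.Reachable v u := by simp [comp]

/-- The nodes of the component of the new node `w_j` in a planted graph. -/
def plantedComp (F : SimpleGraph (Fin n)) (S : Fin k → Fin n) (J : Finset (Fin k)) (j : Fin k) :
    Set (Fin n ⊕ Fin k) :=
  {w | Sum.elim (fun v => F.Reachable (S j) v) (fun i => i ∈ J ∧ F.Reachable (S j) (S i)) w}

lemma isActiveUnion_plantedComp {j : Fin k} (hj : j ∈ J) :
    IsActiveUnion (plantedAt F S J) (plantedComp F S J j) where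
  closed := by
    rintro (u | i) (v | i') h hu
    · exact SimpleGraph.Reachable.trans (v := u) hu (SimpleGraph.Adj.reachable h)
    · exact ⟨h.1, h.2 ▸ hu⟩
    · exact h.2 ▸ hu.2
    · exact h.elim
  reach := by
    have key : ∀ v, F.Reachable (S j) v →
        (plantedAt F S J).Reachable (Sum.inr j) (Sum.inl v) := by
      intro v hv
      have h1 : (plantedAt F S J).Adj (Sum.inr j) (Sum.inl (S j)) := ⟨hj, rfl⟩
      exact h1.reachable.trans
        (hv.map (⟨Sum.inl, fun h => h⟩ : F →g plantedAt F S J))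
    rintro (v | i) hv
    · exact ⟨j, key v hv⟩
    · have h1 : (plantedAt F S J).Adj (Sum.inl (S i)) (Sum.inr i) := ⟨hv.1, rfl⟩
      exact ⟨j, (key _ hv.2).trans h1.reachable⟩

open Classical in
lemma edgesWithin_plantedComp {j : Fin k} :
    edgesWithin (plantedAt F S J) (plantedComp F S J j) =
      (edgesWithin F (comp F (S j))).image (Sym2.map Sum.inl) ∪
        (J.filter fun i => F.Reachable (S j) (S i)).image
          (fun i => s(Sum.inl (S i), Sum.inr i)) := by
  ext e
  simp only [mem_edgesWithin, Finset.mem_union, Finset.mem_image, Finset.mem_filter]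
  constructor
  · rintro ⟨he, hX⟩
    induction e with
    | _ a b =>
      have ha := hX a (by simp)
      have hb := hX b (by simp)
      have hab : (plantedAt F S J).Adj a b := by simpa using he
      rcases a with u | i <;> rcases b with v | i'
      · left
        refine ⟨s(u, v), ⟨hab, fun w hw => ?_⟩, by simp⟩
        rcases Sym2.mem_iff.1 hw with rfl | rfl
        · exact mem_comp.2 ha
        · exact mem_comp.2 hb
      · right
        exact ⟨i', hb, by rw [hab.2]⟩
      · right
        exact ⟨i, ha, by rw [hab.2, Sym2.eq_swap]⟩
      · exact hab.elim
  · rintro (⟨e, ⟨he, hX⟩, rfl⟩ | ⟨i, ⟨hi, hr⟩, rfl⟩)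
    · induction e with
      | _ a b =>
        have ha := hX a (by simp)
        have hb := hX b (by simp)
        refine ⟨he, fun w hw => ?_⟩
        rw [Sym2.map_mk, Sym2.mem_iff] at hw
        rcases hw with rfl | rfl
        · exact mem_comp.1 ha
        · exact mem_comp.1 hb
    · refine ⟨⟨hi, rfl⟩, fun w hw => ?_⟩
      rw [Sym2.mem_iff] at hw
      rcases hw with rfl | rfl
      · exact hr
      · exact ⟨hi, hr⟩

open Classical in
lemma sum_edgesWithin_plantedComp {j : Fin k} (h : Sym2 (Fin n ⊕ Fin k) → ℝ) :
    ∑ e ∈ edgesWithin (plantedAt F S J) (plantedComp F S J j), h e =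
      (∑ e ∈ edgesWithin F (comp F (S j)), h (e.map Sum.inl)) +
        ∑ i ∈ J.filter (fun i => F.Reachable (S j) (S i)), h s(Sum.inl (S i), Sum.inr i) := by
  rw [edgesWithin_plantedComp, Finset.sum_union, Finset.sum_image, Finset.sum_image]
  · intro a _ b _ hab
    simpa using (by simpa using hab : S a = S b ∧ a = b).2
  · exact fun a _ b _ hab => Sym2.map.injective Sum.inl_injective hab
  · rw [Finset.disjoint_left]
    intro e he he'
    obtain ⟨e, -, rfl⟩ := Finset.mem_image.1 he
    obtain ⟨i, -, hi⟩ := Finset.mem_image.1 he'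
    have : Sum.inr i ∈ Sym2.map (Sum.inl : Fin n → Fin n ⊕ Fin k) e := by rw [← hi]; simp
    rw [Sym2.mem_map] at this
    obtain ⟨a, -, ha⟩ := this
    cases ha

lemma card_edgesWithin_comp (hF : F.IsAcyclic) (v : Fin n) :
    (edgesWithin F (comp F v)).card + 1 = (comp F v).card := by
  classical
  set c := F.connectedComponentMk v with hc
  have hsupp : ∀ u, u ∈ c.supp ↔ u ∈ comp F v := by
    intro u
    rw [SimpleGraph.ConnectedComponent.mem_supp_iff, hc, SimpleGraph.ConnectedComponent.eq,
      mem_comp, SimpleGraph.reachable_comm]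
  have htree := hF.isTree_connectedComponent c
  have hcard := htree.card_edgeFinset
  have h1 : Fintype.card c = (comp F v).card := by
    convert Fintype.card_of_subtype (comp F v) fun u => (hsupp u).symm
    exact Iff.rfl
  have h2 : (edgesWithin F (comp F v)) = c.toSimpleGraph.edgeFinset.image (Sym2.map Subtype.val) := by
    ext e
    simp only [mem_edgesWithin, Finset.mem_image, SimpleGraph.mem_edgeFinset]
    constructor
    · rintro ⟨he, hX⟩
      induction e with
      | _ a b =>
        refine ⟨s(⟨a, (hsupp a).2 (hX a (by simp))⟩, ⟨b, (hsupp b).2 (hX b (by simp))⟩), ?_, by simp⟩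
        exact he
    · rintro ⟨e, he, rfl⟩
      induction e with
      | _ a b =>
        refine ⟨he, fun w hw => ?_⟩
        rw [Sym2.map_mk, Sym2.mem_iff] at hw
        rcases hw with rfl | rfl
        · exact (hsupp _).1 a.2
        · exact (hsupp _).1 b.2
  rw [h2, Finset.card_image_of_injective _ (Sym2.map.injective Subtype.val_injective), hcard, h1]

open Classical in
/-- The first cut in the component of `w_j`, written as if it were chosen among the edges of the
forest and the planted edge at `w_j` only, of which there are as many as nodes of the forest in that
component; the last sum corrects for the other planted edges. -/
theorem card_comp_mul_meanCut (hF : F.IsAcyclic) {j : Fin k} (hj : j ∈ J) (φ : ℕ → ℝ) :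
    ((comp F (S j)).card : ℝ) * meanCut φ (plantedAt F S J) =
      (∑ e ∈ edgesWithin F (comp F (S j)),
        meanCut (fun m => φ (m + 1)) (plantedAt (F.deleteEdges {e}) S J)) +
      meanCut (fun m => φ (m + 1)) (plantedAt F S (J.erase j)) +
      ∑ i ∈ J.erase j, if S i ∈ comp F (S j) then
        meanCut (fun m => φ (m + 1)) (plantedAt F S (J.erase i)) - meanCut φ (plantedAt F S J)
        else 0 := by
  have h := (isActiveUnion_plantedComp (F := F) (S := S) hj).card_mul_meanCut φ
  have hcard : ((edgesWithin (plantedAt F S J) (plantedComp F S J j)).card : ℝ) =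
      (edgesWithin F (comp F (S j))).card +
        (J.filter fun i => F.Reachable (S j) (S i)).card := by
    have := sum_edgesWithin_plantedComp (F := F) (S := S) (J := J) (j := j) fun _ => 1
    simpa using this
  have hc : ((edgesWithin F (comp F (S j))).card : ℝ) + 1 = (comp F (S j)).card := by
    exact_mod_cast card_edgesWithin_comp hF (S j)
  rw [hcard, sum_edgesWithin_plantedComp] at h
  have he : ∀ e : Sym2 (Fin n), (plantedAt F S J).deleteEdges {e.map Sum.inl} =
      plantedAt (F.deleteEdges {e}) S J := by
    intro e
    induction e with
    | _ a b => exact plantedAt_deleteEdges_inl a b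
  simp only [he, plantedAt_deleteEdges_inr] at h
  have hfilter : (J.filter fun i => F.Reachable (S j) (S i)) =
      insert j ((J.erase j).filter fun i => F.Reachable (S j) (S i)) := by
    ext i
    simp only [Finset.mem_filter, Finset.mem_insert, Finset.mem_erase]
    constructor
    · rintro ⟨h1, h2⟩
      by_cases hij : i = j
      · exact Or.inl hij
      · exact Or.inr ⟨⟨hij, h1⟩, h2⟩
    · rintro (rfl | ⟨⟨-, h1⟩, h2⟩)
      · exact ⟨hj, SimpleGraph.Reachable.refl _⟩
      · exact ⟨h1, h2⟩
  rw [hfilter, Finset.sum_insert (by simp), Finset.card_insert_of_notMem (by simp)] at h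
  simp only [mem_comp]
  rw [← Finset.sum_filter, Finset.sum_sub_distrib, Finset.sum_const, nsmul_eq_mul]
  push_cast at h
  linear_combination h - meanCut φ (plantedAt F S J) * hc

end Planted

/-! ### Rooted forests -/

section Forests

variable {n : ℕ} {F : SimpleGraph (Fin n)} {R : Finset (Fin n)}

lemma reachable_sup_edge_iff {V : Type*} {F : SimpleGraph V} {x y u v : V} :
    (F ⊔ SimpleGraph.edge x y).Reachable u v ↔ F.Reachable u v ∨
      (F.Reachable u x ∧ F.Reachable y v) ∨ (F.Reachable u y ∧ F.Reachable x v) := by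
  constructor
  · rintro ⟨w⟩
    induction w with
    | nil => exact Or.inl (SimpleGraph.Reachable.refl _)
    | @cons a b c hab w ih =>
      rw [SimpleGraph.sup_adj, SimpleGraph.edge_adj] at hab
      have hrefl := fun z : V => SimpleGraph.Reachable.refl (G := F) z
      rcases hab with hab | ⟨⟨rfl, rfl⟩ | ⟨rfl, rfl⟩, -⟩
      · have hab := hab.reachable
        rcases ih with h | ⟨h1, h2⟩ | ⟨h1, h2⟩
        · exact Or.inl (hab.trans h)
        · exact Or.inr (Or.inl ⟨hab.trans h1, h2⟩)
        · exact Or.inr (Or.inr ⟨hab.trans h1, h2⟩)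
      · rcases ih with h | ⟨h1, h2⟩ | ⟨h1, h2⟩
        · exact Or.inr (Or.inl ⟨hrefl _, h⟩)
        · exact Or.inr (Or.inl ⟨hrefl _, h2⟩)
        · exact Or.inl h2
      · rcases ih with h | ⟨h1, h2⟩ | ⟨h1, h2⟩
        · exact Or.inr (Or.inr ⟨hrefl _, h⟩)
        · exact Or.inl h2
        · exact Or.inr (Or.inr ⟨hrefl _, h2⟩)
  · have hle : F ≤ F ⊔ SimpleGraph.edge x y := le_sup_left
    have hxy : (F ⊔ SimpleGraph.edge x y).Reachable x y := by
      by_cases h : x = y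
      · rw [h]
      · exact SimpleGraph.Adj.reachable (by simp [SimpleGraph.edge_adj, h])
    rintro (h | ⟨h1, h2⟩ | ⟨h1, h2⟩)
    · exact h.mono hle
    · exact (h1.mono hle).trans (hxy.trans (h2.mono hle))
    · exact (h1.mono hle).trans (hxy.symm.trans (h2.mono hle))

lemma deleteEdges_sup_edge {V : Type*} {F : SimpleGraph V} {x y : V} (h : F.Adj x y) :
    F.deleteEdges {s(x, y)} ⊔ SimpleGraph.edge x y = F := by
  ext a b
  simp only [SimpleGraph.sup_adj, SimpleGraph.deleteEdges_adj, SimpleGraph.edge_adj,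
    Set.mem_singleton_iff, Sym2.eq_iff]
  constructor
  · rintro (h' | ⟨⟨rfl, rfl⟩ | ⟨rfl, rfl⟩, -⟩)
    · exact h'.1
    · exact h
    · exact h.symm
  · intro h'
    have := h'.ne
    tauto

lemma sup_edge_deleteEdges {V : Type*} {F : SimpleGraph V} {x y : V} (h : ¬ F.Adj x y) :
    (F ⊔ SimpleGraph.edge x y).deleteEdges {s(x, y)} = F := by
  ext a b
  simp only [SimpleGraph.sup_adj, SimpleGraph.deleteEdges_adj, SimpleGraph.edge_adj,
    Set.mem_singleton_iff, Sym2.eq_iff]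
  constructor
  · tauto
  · intro h'
    refine ⟨Or.inl h', ?_⟩
    rintro (⟨rfl, rfl⟩ | ⟨rfl, rfl⟩)
    · exact h h'
    · exact h h'.symm

/-- `R` is a set of roots for `F`: it has exactly one node in each connected component. -/
structure IsRootSet (F : SimpleGraph (Fin n)) (R : Finset (Fin n)) : Prop where
  exists_root : ∀ v, ∃ r ∈ R, F.Reachable v r
  eq_of_reachable : ∀ r ∈ R, ∀ s ∈ R, F.Reachable r s → r = s

open Classical in
/-- The rooted forests on `Fin n` with `d` trees, as pairs of an acyclic graph and its set of
roots. -/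
noncomputable def rootedForests (n d : ℕ) : Finset (SimpleGraph (Fin n) × Finset (Fin n)) :=
  Finset.univ.filter fun p => p.1.IsAcyclic ∧ IsRootSet p.1 p.2 ∧ p.2.card = d

lemma mem_rootedForests {d : ℕ} {p : SimpleGraph (Fin n) × Finset (Fin n)} :
    p ∈ rootedForests n d ↔ p.1.IsAcyclic ∧ IsRootSet p.1 p.2 ∧ p.2.card = d := by
  simp [rootedForests]

lemma sum_card_comp (hR : IsRootSet F R) : ∑ v ∈ R, (comp F v).card = n := by
  classical
  rw [← Finset.card_biUnion]
  · rw [show R.biUnion (comp F) = Finset.univ from ?_, Finset.card_fin]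
    ext v
    obtain ⟨r, hr, hvr⟩ := hR.exists_root v
    simp only [Finset.mem_biUnion, Finset.mem_univ, iff_true]
    exact ⟨r, hr, mem_comp.2 hvr.symm⟩
  · intro a ha b hb hab
    refine Finset.disjoint_left.2 fun v hva hvb => ?_
    exact hab (hR.eq_of_reachable a ha b hb ((mem_comp.1 hva).trans (mem_comp.1 hvb).symm))

open Classical in
/-- Summing over all the nodes is the same as summing over the roots, each weighted by the size of
its tree, because in a uniform rooted forest every node of a tree may be its root. -/
lemma sum_rootedForests_sum_univ (d : ℕ) (f : SimpleGraph (Fin n) → Fin n → ℝ) :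
    ∑ p ∈ rootedForests n d, ∑ v, f p.1 v =
      ∑ p ∈ rootedForests n d, ∑ v ∈ p.2, ((comp p.1 v).card : ℝ) * f p.1 v := by
  have key : ∀ (g : SimpleGraph (Fin n) → Finset (Fin n) → ℝ),
      ∑ p ∈ rootedForests n d, g p.1 p.2 =
        ∑ F ∈ Finset.univ.filter (fun F : SimpleGraph (Fin n) => F.IsAcyclic),
          ∑ R ∈ Finset.univ.filter (fun R => IsRootSet F R ∧ R.card = d), g F R := by
    intro g
    rw [rootedForests, Finset.sum_filter, Fintype.sum_prod_type, Finset.sum_filter]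
    refine Finset.sum_congr rfl fun F _ => ?_
    split_ifs with h
    · simp [h, Finset.sum_filter]
    · simp [h]
  rw [key (fun F R => ∑ v, f F v),
    key (fun F R => ∑ v ∈ R, ((comp F v).card : ℝ) * f F v)]
  refine Finset.sum_congr rfl fun F _ => ?_
  set T := Finset.univ.filter (fun R => IsRootSet F R ∧ R.card = d) with hT
  -- swapping two nodes of the same tree maps root sets to root sets
  have hswap : ∀ v x, F.Reachable v x →
      (T.filter (v ∈ ·)).card = (T.filter (x ∈ ·)).card := by
    intro v x hvx
    have hs : ∀ w, F.Reachable w (Equiv.swap v x w) := by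
      intro w
      rcases eq_or_ne w v with rfl | hv
      · simpa using hvx
      rcases eq_or_ne w x with rfl | hx
      · simpa using hvx.symm
      · rw [Equiv.swap_apply_of_ne_of_ne hv hx]
    have hmap : ∀ R ∈ T, R.map (Equiv.swap v x).toEmbedding ∈ T := by
      intro R hR
      simp only [hT, Finset.mem_filter, Finset.mem_univ, true_and] at hR ⊢
      refine ⟨⟨fun w => ?_, fun r hr s hs' hrs => ?_⟩, by simpa using hR.2⟩
      · obtain ⟨r, hr, hwr⟩ := hR.1.exists_root w
        exact ⟨_, Finset.mem_map_of_mem _ hr, hwr.trans (hs r)⟩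
      · obtain ⟨r, hr', rfl⟩ := Finset.mem_map.1 hr
        obtain ⟨s, hs'', rfl⟩ := Finset.mem_map.1 hs'
        rw [hR.1.eq_of_reachable r hr' s hs'' ((hs r).trans (hrs.trans (hs s).symm))]
    have hinv : ∀ R : Finset (Fin n), (R.map (Equiv.swap v x).toEmbedding).map
        (Equiv.swap v x).toEmbedding = R := by
      intro R
      rw [Finset.map_map]
      convert Finset.map_refl
      ext w
      simp
    refine Finset.card_nbij' (fun R => R.map (Equiv.swap v x).toEmbedding)
      (fun R => R.map (Equiv.swap v x).toEmbedding) ?_ ?_ (fun R _ => hinv R) (fun R _ => hinv R)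
    · intro R hR
      obtain ⟨hR, hv⟩ := Finset.mem_filter.1 hR
      exact Finset.mem_filter.2 ⟨hmap R hR, Finset.mem_map.2 ⟨v, hv, by simp⟩⟩
    · intro R hR
      obtain ⟨hR, hv⟩ := Finset.mem_filter.1 hR
      exact Finset.mem_filter.2 ⟨hmap R hR, Finset.mem_map.2 ⟨x, hv, by simp⟩⟩
  have hcount : ∀ v, (comp F v).card * (T.filter (v ∈ ·)).card = T.card := by
    intro v
    calc (comp F v).card * (T.filter (v ∈ ·)).card
        = ∑ x ∈ comp F v, (T.filter (x ∈ ·)).card := by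
          rw [Finset.sum_congr rfl fun x hx => (hswap v x (mem_comp.1 hx)).symm]
          simp
      _ = ∑ R ∈ T, ((comp F v).filter (· ∈ R)).card := by
          simp only [Finset.card_filter]
          exact Finset.sum_comm
      _ = ∑ R ∈ T, 1 := by
          refine Finset.sum_congr rfl fun R hR => ?_
          simp only [hT, Finset.mem_filter, Finset.mem_univ, true_and] at hR
          rw [Finset.card_eq_one]
          obtain ⟨r, hr, hvr⟩ := hR.1.exists_root v
          refine ⟨r, ?_⟩
          ext x
          simp only [Finset.mem_filter, Finset.mem_singleton, mem_comp]
          constructor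
          · rintro ⟨h1, h2⟩
            exact hR.1.eq_of_reachable x h2 r hr (h1.symm.trans hvr)
          · rintro rfl
            exact ⟨hvr, hr⟩
      _ = T.card := by simp
  calc ∑ R ∈ T, ∑ v, f F v = ∑ v, (T.card : ℝ) * f F v := by
        rw [Finset.sum_comm]; simp
    _ = ∑ v, ∑ R ∈ T, if v ∈ R then ((comp F v).card : ℝ) * f F v else 0 := by
        refine Finset.sum_congr rfl fun v _ => ?_
        rw [← hcount v, ← Finset.sum_filter, Finset.sum_const, nsmul_eq_mul]
        push_cast
        ring
    _ = ∑ R ∈ T, ∑ v ∈ R, ((comp F v).card : ℝ) * f F v := by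
        rw [Finset.sum_comm]
        refine Finset.sum_congr rfl fun R _ => ?_
        simp

open Classical in
/-- The edges of the component of `v` in the forest `F`, as pairs `(x, y)` oriented away from `v`:
after the removal of `xy`, the node `x` is still connected to `v`. -/
noncomputable def dartsFrom (F : SimpleGraph (Fin n)) (v : Fin n) : Finset (Fin n × Fin n) :=
  Finset.univ.filter fun z => F.Adj z.1 z.2 ∧ (F.deleteEdges {s(z.1, z.2)}).Reachable v z.1

lemma mem_dartsFrom {v : Fin n} {z : Fin n × Fin n} : z ∈ dartsFrom F v ↔
    F.Adj z.1 z.2 ∧ (F.deleteEdges {s(z.1, z.2)}).Reachable v z.1 := by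
  simp [dartsFrom]

lemma not_reachable_deleteEdges (hF : F.IsAcyclic) {x y : Fin n} (h : F.Adj x y) :
    ¬ (F.deleteEdges {s(x, y)}).Reachable x y :=
  SimpleGraph.isAcyclic_iff_forall_adj_isBridge.1 hF h

lemma sum_edgesWithin_comp (hF : F.IsAcyclic) (v : Fin n) (h : Sym2 (Fin n) → ℝ) :
    ∑ e ∈ edgesWithin F (comp F v), h e = ∑ z ∈ dartsFrom F v, h s(z.1, z.2) := by
  symm
  refine Finset.sum_bij (fun z _ => s(z.1, z.2)) ?_ ?_ ?_ (fun _ _ => rfl)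
  · rintro ⟨x, y⟩ hz
    rw [mem_dartsFrom] at hz
    have hx := hz.2.mono (SimpleGraph.deleteEdges_le _)
    refine mem_edgesWithin.2 ⟨hz.1, fun w hw => mem_comp.2 ?_⟩
    rcases Sym2.mem_iff.1 hw with rfl | rfl
    · exact hx
    · exact hx.trans hz.1.reachable
  · rintro ⟨x, y⟩ hz ⟨x', y'⟩ hz' heq
    rw [mem_dartsFrom] at hz hz'
    rcases Sym2.eq_iff.1 heq with ⟨h1, h2⟩ | ⟨h1, h2⟩
    · exact Prod.ext h1 h2
    · dsimp only at h1 h2 hz hz'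
      subst h1 h2
      rw [Sym2.eq_swap] at hz'
      exact (not_reachable_deleteEdges hF hz.1 (hz.2.symm.trans hz'.2)).elim
  · intro e he
    rw [mem_edgesWithin] at he
    induction e with
    | _ x y =>
      have hxy : F.Adj x y := he.1
      have hvx : F.Reachable v x := mem_comp.1 (he.2 x (by simp))
      rw [← deleteEdges_sup_edge hxy, reachable_sup_edge_iff] at hvx
      have : (F.deleteEdges {s(x, y)}).Reachable v x ∨ (F.deleteEdges {s(x, y)}).Reachable v y := by
        tauto
      rcases this with h | h
      · exact ⟨(x, y), mem_dartsFrom.2 ⟨hxy, h⟩, rfl⟩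
      · refine ⟨(y, x), mem_dartsFrom.2 ⟨hxy.symm, ?_⟩, Sym2.eq_swap⟩
        rwa [Sym2.eq_swap]

lemma IsRootSet.deleteEdges (hF : F.IsAcyclic) (hR : IsRootSet F R) {v x y : Fin n} (hv : v ∈ R)
    (hxy : F.Adj x y) (hvx : (F.deleteEdges {s(x, y)}).Reachable v x) :
    y ∉ R ∧ IsRootSet (F.deleteEdges {s(x, y)}) (insert y R) := by
  set F' := F.deleteEdges {s(x, y)} with hF'
  have hle : F' ≤ F := SimpleGraph.deleteEdges_le _
  have hb : ¬ F'.Reachable x y := not_reachable_deleteEdges hF hxy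
  have hvy : ¬ F'.Reachable v y := fun h => hb (hvx.symm.trans h)
  -- the only root in the tree of `F` containing `y` is `v`
  have hroot : ∀ r ∈ R, ¬ F'.Reachable y r := by
    intro r hr hyr
    have : v = r := hR.eq_of_reachable v hv r hr
      ((hvx.mono hle).trans (hxy.reachable.trans (hyr.mono hle)))
    exact hvy (this ▸ hyr.symm)
  refine ⟨fun hy => hroot y hy (SimpleGraph.Reachable.refl _), ⟨fun w => ?_, ?_⟩⟩
  · by_cases hwy : F'.Reachable w y
    · exact ⟨y, Finset.mem_insert_self _ _, hwy⟩
    · obtain ⟨r, hr, hwr⟩ := hR.exists_root w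
      refine ⟨r, Finset.mem_insert_of_mem hr, ?_⟩
      rw [← deleteEdges_sup_edge hxy, reachable_sup_edge_iff] at hwr
      rcases hwr with h | ⟨-, h⟩ | ⟨h, -⟩
      · exact h
      · exact (hroot r hr h).elim
      · exact (hwy h).elim
  · intro r hr s hs hrs
    rw [Finset.mem_insert] at hr hs
    rcases hr with rfl | hr <;> rcases hs with rfl | hs
    · rfl
    · exact (hroot s hs hrs).elim
    · exact (hroot r hr hrs.symm).elim
    · exact hR.eq_of_reachable r hr s hs (hrs.mono hle)

lemma IsRootSet.sup_edge (hR : IsRootSet F R) {v x y : Fin n} (hv : v ∈ R) (hy : y ∈ R)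
    (hyv : y ≠ v) (hvx : F.Reachable v x) :
    ¬ F.Reachable x y ∧ IsRootSet (F ⊔ SimpleGraph.edge x y) (R.erase y) := by
  have hxy : ¬ F.Reachable x y := fun h => hyv (hR.eq_of_reachable v hv y hy (hvx.trans h)).symm
  refine ⟨hxy, fun w => ?_, fun r hr s hs hrs => ?_⟩
  · obtain ⟨r, hr, hwr⟩ := hR.exists_root w
    by_cases hry : r = y
    · subst hry
      exact ⟨v, Finset.mem_erase.2 ⟨hyv.symm, hv⟩,
        reachable_sup_edge_iff.2 (Or.inr (Or.inr ⟨hwr, hvx.symm⟩))⟩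
    · exact ⟨r, Finset.mem_erase.2 ⟨hry, hr⟩, reachable_sup_edge_iff.2 (Or.inl hwr)⟩
  · obtain ⟨hry, hr⟩ := Finset.mem_erase.1 hr
    obtain ⟨hsy, hs⟩ := Finset.mem_erase.1 hs
    rcases reachable_sup_edge_iff.1 hrs with h | ⟨-, h⟩ | ⟨h, -⟩
    · exact hR.eq_of_reachable r hr s hs h
    · exact (hsy (hR.eq_of_reachable y hy s hs h).symm).elim
    · exact (hry (hR.eq_of_reachable r hr y hy h)).elim

open Classical in
/-- Removing an edge from a uniform rooted forest. Cutting the edge above `y` in the tree rooted at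
`v` makes `y` a root; conversely, a forest with `d + 1` trees comes from as many forests with `d`
trees as there are ways to hang one of the `d` trees not containing `v` from a node of the tree
of `v`. -/
theorem sum_rootedForests_deleteEdges (d : ℕ) (f : SimpleGraph (Fin n) → Fin n → ℝ) :
    ∑ p ∈ rootedForests n d, ∑ v ∈ p.2, ∑ e ∈ edgesWithin p.1 (comp p.1 v),
        f (p.1.deleteEdges {e}) v =
      d * ∑ p ∈ rootedForests n (d + 1), ∑ v ∈ p.2, ((comp p.1 v).card : ℝ) * f p.1 v := by
  have h1 : ∑ p ∈ rootedForests n d, ∑ v ∈ p.2, ∑ e ∈ edgesWithin p.1 (comp p.1 v),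
        f (p.1.deleteEdges {e}) v =
      ∑ p ∈ rootedForests n d, ∑ v ∈ p.2, ∑ z ∈ dartsFrom p.1 v,
        f (p.1.deleteEdges {s(z.1, z.2)}) v := by
    refine Finset.sum_congr rfl fun p hp => Finset.sum_congr rfl fun v _ => ?_
    exact sum_edgesWithin_comp (mem_rootedForests.1 hp).1 v _
  have h2 : (d : ℝ) * ∑ p ∈ rootedForests n (d + 1), ∑ v ∈ p.2, ((comp p.1 v).card : ℝ) * f p.1 v =
      ∑ p ∈ rootedForests n (d + 1), ∑ v ∈ p.2, ∑ z ∈ comp p.1 v ×ˢ p.2.erase v, f p.1 v := by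
    rw [Finset.mul_sum]
    refine Finset.sum_congr rfl fun p hp => ?_
    rw [Finset.mul_sum]
    refine Finset.sum_congr rfl fun v hv => ?_
    rw [Finset.sum_const, Finset.card_product, Finset.card_erase_of_mem hv,
      (mem_rootedForests.1 hp).2.2, nsmul_eq_mul, Nat.add_sub_cancel]
    push_cast
    ring
  rw [h1, h2]
  simp only [Finset.sum_sigma']
  refine Finset.sum_nbij'
    (fun q => ⟨(q.1.1.deleteEdges {s(q.2.2.1, q.2.2.2)}, insert q.2.2.2 q.1.2), q.2.1, q.2.2⟩)
    (fun q => ⟨(q.1.1 ⊔ SimpleGraph.edge q.2.2.1 q.2.2.2, q.1.2.erase q.2.2.2), q.2.1, q.2.2⟩)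
    ?_ ?_ ?_ ?_ ?_
  · rintro ⟨⟨F, R⟩, v, x, y⟩ hq
    simp only [Finset.mem_sigma, mem_rootedForests, mem_dartsFrom] at hq
    obtain ⟨⟨hF, hR, hd⟩, hv, hxy, hvx⟩ := hq
    obtain ⟨hy, hR'⟩ := hR.deleteEdges hF hv hxy hvx
    simp only [Finset.mem_sigma, mem_rootedForests, Finset.mem_product, Finset.mem_erase,
      mem_comp]
    refine ⟨⟨hF.anti (SimpleGraph.deleteEdges_le _), hR', ?_⟩, Finset.mem_insert_of_mem hv,
      hvx, ?_, Finset.mem_insert_self _ _⟩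
    · rw [Finset.card_insert_of_notMem hy, hd]
    · rintro rfl
      exact hy hv
  · rintro ⟨⟨F, R⟩, v, x, y⟩ hq
    simp only [Finset.mem_sigma, mem_rootedForests, Finset.mem_product, Finset.mem_erase,
      mem_comp] at hq
    obtain ⟨⟨hF, hR, hd⟩, hv, hvx, hyv, hy⟩ := hq
    obtain ⟨hxy, hR'⟩ := hR.sup_edge hv hy hyv hvx
    simp only [Finset.mem_sigma, mem_rootedForests, mem_dartsFrom]
    refine ⟨⟨hF.sup_edge_of_not_reachable hxy, hR', ?_⟩, Finset.mem_erase.2 ⟨hyv.symm, hv⟩,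
      ?_, ?_⟩
    · rw [Finset.card_erase_of_mem hy, hd, Nat.add_sub_cancel]
    · have : x ≠ y := fun h => hxy (h ▸ SimpleGraph.Reachable.refl _)
      simp [SimpleGraph.edge_adj, this]
    · rwa [sup_edge_deleteEdges fun h => hxy h.reachable]
  · rintro ⟨⟨F, R⟩, v, x, y⟩ hq
    simp only [Finset.mem_sigma, mem_rootedForests, mem_dartsFrom] at hq
    obtain ⟨⟨hF, hR, hd⟩, hv, hxy, hvx⟩ := hq
    obtain ⟨hy, hR'⟩ := hR.deleteEdges hF hv hxy hvx
    simp only [deleteEdges_sup_edge hxy, Finset.erase_insert hy]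
  · rintro ⟨⟨F, R⟩, v, x, y⟩ hq
    simp only [Finset.mem_sigma, mem_rootedForests, Finset.mem_product, Finset.mem_erase,
      mem_comp] at hq
    obtain ⟨⟨hF, hR, hd⟩, hv, hvx, hyv, hy⟩ := hq
    obtain ⟨hxy, hR'⟩ := hR.sup_edge hv hy hyv hvx
    simp only [sup_edge_deleteEdges fun h => hxy h.reachable, Finset.insert_erase hy]
  · intro q _
    rfl

/-- The recursion for the numbers of rooted forests. -/
lemma card_rootedForests_succ (n d : ℕ) :
    ((rootedForests n d).card : ℝ) * (n - d) = d * n * (rootedForests n (d + 1)).card := by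
  have hsum : ∀ {d : ℕ}, ∀ p ∈ rootedForests n d, ∑ v ∈ p.2, ((comp p.1 v).card : ℝ) = n := by
    intro d p hp
    exact_mod_cast sum_card_comp (mem_rootedForests.1 hp).2.1
  have h := sum_rootedForests_deleteEdges d fun (_ : SimpleGraph (Fin n)) _ => 1
  simp only [mul_one] at h
  rw [Finset.sum_congr rfl hsum] at h
  rw [Finset.sum_congr rfl (g := fun p => (n : ℝ) - d)] at h
  · simp only [Finset.sum_const, nsmul_eq_mul] at h
    linear_combination h
  · intro p hp
    rw [← hsum p hp, ← (mem_rootedForests.1 hp).2.2, Finset.card_eq_sum_ones, Nat.cast_sum,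
      ← Finset.sum_sub_distrib]
    refine Finset.sum_congr rfl fun v _ => ?_
    have : ((edgesWithin p.1 (comp p.1 v)).card : ℝ) + 1 = (comp p.1 v).card := by
      exact_mod_cast card_edgesWithin_comp (mem_rootedForests.1 hp).1 v
    simp [← this]

lemma rootedForests_eq_empty {n d : ℕ} (h : n < d) : rootedForests n d = ∅ := by
  rw [Finset.eq_empty_iff_forall_notMem]
  intro p hp
  have := (mem_rootedForests.1 hp).2.2
  have := Finset.card_le_univ p.2
  simp at this
  omega

end Forests

/-! ### The recursion for uniform rooted forests -/

section Recursion

variable {n k : ℕ}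

lemma sum_sum_update (i : Fin k) (h : (Fin k → Fin n) → ℝ) :
    ∑ S, ∑ v, h (Function.update S i v) = n * ∑ S, h S := by
  rw [← Fintype.sum_prod_type']
  have : ∑ p : (Fin k → Fin n) × Fin n, h (Function.update p.1 i p.2) =
      ∑ p : (Fin k → Fin n) × Fin n, h p.1 := by
    refine Finset.sum_nbij' (fun p => (Function.update p.1 i p.2, p.1 i))
      (fun p => (Function.update p.1 i p.2, p.1 i)) ?_ ?_ ?_ ?_ ?_ <;> simp
  rw [this, Fintype.sum_prod_type]
  simp [Finset.mul_sum]

/-- Averaging over the position of one of the nodes, on which nothing else depends. -/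
lemma mul_sum_ite_mem (i : Fin k) (T : (Fin k → Fin n) → Finset (Fin n))
    (g : (Fin k → Fin n) → ℝ) (hT : ∀ S v, T (Function.update S i v) = T S)
    (hg : ∀ S v, g (Function.update S i v) = g S) :
    n * ∑ S, (if S i ∈ T S then g S else 0) = ∑ S, ((T S).card : ℝ) * g S := by
  rw [← sum_sum_update i]
  refine Finset.sum_congr rfl fun S _ => ?_
  simp [hT, hg]

lemma sum_ite_mem_eq_sum_sum (j : Fin k) (R : Finset (Fin n)) (G : Fin n → (Fin k → Fin n) → ℝ) :
    ∑ S, (if S j ∈ R then G (S j) S else 0) = ∑ v ∈ R, ∑ S, if S j = v then G v S else 0 := by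
  rw [Finset.sum_comm]
  refine Finset.sum_congr rfl fun S _ => ?_
  by_cases h : S j ∈ R
  · rw [if_pos h, Finset.sum_eq_single (S j)]
    · simp
    · intro b _ hb
      rw [if_neg (Ne.symm hb)]
    · exact fun h' => (h' h).elim
  · rw [if_neg h]
    refine (Finset.sum_eq_zero fun v hv => if_neg ?_).symm
    rintro rfl
    exact h hv

lemma sum_rootedForests_sum_nodes (d : ℕ) (j : Fin k)
    (h : SimpleGraph (Fin n) → (Fin k → Fin n) → ℝ) :
    ∑ p ∈ rootedForests n d, ∑ S, h p.1 S =
      ∑ p ∈ rootedForests n d, ∑ S : Fin k → Fin n,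
        if S j ∈ p.2 then ((comp p.1 (S j)).card : ℝ) * h p.1 S else 0 := by
  have h1 := sum_rootedForests_sum_univ d fun (F : SimpleGraph (Fin n)) v =>
    ∑ S, if S j = v then h F S else 0
  have h2 : ∀ F : SimpleGraph (Fin n), ∑ v, ∑ S, (if S j = v then h F S else 0) = ∑ S, h F S := by
    intro F
    rw [Finset.sum_comm]
    simp
  simp only [h2] at h1
  rw [h1]
  refine Finset.sum_congr rfl fun p _ => ?_
  rw [sum_ite_mem_eq_sum_sum j p.2 fun v S => ((comp p.1 v).card : ℝ) * h p.1 S]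
  simp only [Finset.mul_sum, mul_ite, mul_zero]

/-- The sum of the expectations of `φ M` over all the rooted forests with `d` trees and all the
sequences `S`, where `M` is the number of cuts when new nodes are planted at the `S i` with
`i ∈ J`. -/
noncomputable def totalMean (φ : ℕ → ℝ) (n d : ℕ) (J : Finset (Fin k)) : ℝ :=
  ∑ p ∈ rootedForests n d, ∑ S : Fin k → Fin n, meanCut φ (plantedAt p.1 S J)

/-- The contribution to `totalMean` of the cuts of the planted edges other than the one at `w_j`
in the component of `w_j`. -/
noncomputable def cutError (φ : ℕ → ℝ) (n d : ℕ) (J : Finset (Fin k)) (j : Fin k) : ℝ :=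
  ∑ i ∈ J.erase j, ∑ p ∈ rootedForests n d, ∑ S : Fin k → Fin n,
    if S j ∈ p.2 ∧ S i ∈ comp p.1 (S j) then
      meanCut (fun m => φ (m + 1)) (plantedAt p.1 S (J.erase i)) - meanCut φ (plantedAt p.1 S J)
    else 0

lemma plantedAt_update_of_notMem {F : SimpleGraph (Fin n)} {J : Finset (Fin k)} {i : Fin k}
    (hi : i ∉ J) (S : Fin k → Fin n) (v : Fin n) :
    plantedAt F (Function.update S i v) J = plantedAt F S J := by
  refine plantedAt_congr fun a ha => Function.update_of_ne ?_ _ _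
  rintro rfl
  exact hi ha

/-- The first cut in the component of `w_j`, averaged over uniform rooted forests: up to the error
term, either it isolates `w_j`, with probability `d / n`, or it turns the forest into a uniform
rooted forest with one more tree. -/
theorem totalMean_eq [NeZero n] (φ : ℕ → ℝ) (d : ℕ) {J : Finset (Fin k)} {j : Fin k}
    (hj : j ∈ J) :
    totalMean φ n d J = d * totalMean (fun m => φ (m + 1)) n (d + 1) J +
      d / n * totalMean (fun m => φ (m + 1)) n d (J.erase j) + cutError φ n d J j := by
  have hn : (n : ℝ) ≠ 0 := Nat.cast_ne_zero.2 (NeZero.ne n)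
  have h1 : ∑ p ∈ rootedForests n d, ∑ S : Fin k → Fin n, (if S j ∈ p.2 then
        ∑ e ∈ edgesWithin p.1 (comp p.1 (S j)),
          meanCut (fun m => φ (m + 1)) (plantedAt (p.1.deleteEdges {e}) S J) else 0) =
      d * totalMean (fun m => φ (m + 1)) n (d + 1) J := by
    set f : SimpleGraph (Fin n) → Fin n → ℝ := fun F v => ∑ S : Fin k → Fin n,
      if S j = v then meanCut (fun m => φ (m + 1)) (plantedAt F S J) else 0 with hf
    have h := sum_rootedForests_deleteEdges d f
    rw [← sum_rootedForests_sum_univ] at h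
    have h2 : ∀ F : SimpleGraph (Fin n), ∑ v, f F v =
        ∑ S : Fin k → Fin n, meanCut (fun m => φ (m + 1)) (plantedAt F S J) := by
      intro F
      rw [hf, Finset.sum_comm]
      simp
    simp only [h2] at h
    rw [totalMean, ← h]
    refine Finset.sum_congr rfl fun p _ => ?_
    rw [sum_ite_mem_eq_sum_sum j p.2 fun v S => ∑ e ∈ edgesWithin p.1 (comp p.1 v),
          meanCut (fun m => φ (m + 1)) (plantedAt (p.1.deleteEdges {e}) S J)]
    refine Finset.sum_congr rfl fun v _ => ?_
    rw [hf, Finset.sum_comm]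
    refine Finset.sum_congr rfl fun S _ => ?_
    split_ifs <;> simp
  have h2 : ∑ p ∈ rootedForests n d, ∑ S : Fin k → Fin n, (if S j ∈ p.2 then
        meanCut (fun m => φ (m + 1)) (plantedAt p.1 S (J.erase j)) else 0) =
      d / n * totalMean (fun m => φ (m + 1)) n d (J.erase j) := by
    rw [totalMean, Finset.mul_sum]
    refine Finset.sum_congr rfl fun p hp => ?_
    have := mul_sum_ite_mem j (fun _ => p.2)
      (fun S => meanCut (fun m => φ (m + 1)) (plantedAt p.1 S (J.erase j))) (fun _ _ => rfl)
      (fun S v => by rw [plantedAt_update_of_notMem (Finset.notMem_erase j J)])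
    rw [(mem_rootedForests.1 hp).2.2, ← Finset.mul_sum] at this
    rw [div_mul_eq_mul_div, eq_div_iff hn, ← this, mul_comm]
  have h3 : cutError φ n d J j = ∑ p ∈ rootedForests n d, ∑ S : Fin k → Fin n,
      if S j ∈ p.2 then ∑ i ∈ J.erase j, (if S i ∈ comp p.1 (S j) then
        meanCut (fun m => φ (m + 1)) (plantedAt p.1 S (J.erase i)) -
          meanCut φ (plantedAt p.1 S J) else 0) else 0 := by
    rw [cutError, Finset.sum_comm]
    refine Finset.sum_congr rfl fun p _ => ?_
    rw [Finset.sum_comm]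
    refine Finset.sum_congr rfl fun S _ => ?_
    by_cases h : S j ∈ p.2 <;> simp [h]
  rw [← h1, ← h2, h3, totalMean,
    sum_rootedForests_sum_nodes d j fun F S => meanCut φ (plantedAt F S J)]
  simp only [← Finset.sum_add_distrib]
  refine Finset.sum_congr rfl fun p hp => Finset.sum_congr rfl fun S _ => ?_
  by_cases h : S j ∈ p.2
  · simp only [if_pos h]
    exact card_comp_mul_meanCut (mem_rootedForests.1 hp).1 hj φ
  · simp [h]

/-- The node `S i` falls in the tree of `S j` with a probability proportional to the size of that
tree. -/
lemma sum_ite_mem_comp [NeZero n] (d : ℕ) {i j : Fin k} (hij : i ≠ j)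
    (g : SimpleGraph (Fin n) → (Fin k → Fin n) → ℝ)
    (hg : ∀ F S v, g F (Function.update S i v) = g F S) :
    ∑ p ∈ rootedForests n d, ∑ S : Fin k → Fin n,
        (if S j ∈ p.2 ∧ S i ∈ comp p.1 (S j) then g p.1 S else 0) =
      (∑ p ∈ rootedForests n d, ∑ S, g p.1 S) / n := by
  have hn : (n : ℝ) ≠ 0 := Nat.cast_ne_zero.2 (NeZero.ne n)
  rw [sum_rootedForests_sum_nodes d j, eq_div_iff hn, Finset.sum_mul]
  refine Finset.sum_congr rfl fun p _ => ?_
  have := mul_sum_ite_mem i (fun S => comp p.1 (S j)) (fun S => if S j ∈ p.2 then g p.1 S else 0)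
    (fun S v => by simp only [Function.update_of_ne hij.symm])
    (fun S v => by simp only [Function.update_of_ne hij.symm, hg])
  rw [mul_comm]
  simp only [mul_ite, mul_zero] at this
  rw [← this]
  congr 1
  refine Finset.sum_congr rfl fun S _ => ?_
  by_cases h1 : S j ∈ p.2 <;> by_cases h2 : S i ∈ comp p.1 (S j) <;> simp [h1, h2]

/-- The number of rooted forests with `d` trees together with a sequence of `k` nodes. -/
noncomputable def totalCount (n k d : ℕ) : ℝ := (rootedForests n d).card * (n : ℝ) ^ k

lemma totalCount_nonneg (n k d : ℕ) : 0 ≤ totalCount n k d := by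
  unfold totalCount; positivity

lemma totalCount_succ (n k d : ℕ) :
    d * totalCount n k (d + 1) * n = totalCount n k d * (n - d) := by
  unfold totalCount
  linear_combination -(n : ℝ) ^ k * card_rootedForests_succ n d

lemma totalCount_eq_zero {n d : ℕ} (k : ℕ) (h : n < d) : totalCount n k d = 0 := by
  simp [totalCount, rootedForests_eq_empty h]

lemma totalMean_const (c : ℝ) (n d : ℕ) (J : Finset (Fin k)) :
    totalMean (fun _ => c) n d J = c * totalCount n k d := by
  simp [totalMean, totalCount, meanCut_const]
  ring

lemma totalMean_empty (φ : ℕ → ℝ) (n d : ℕ) :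
    totalMean φ n d (∅ : Finset (Fin k)) = φ 0 * totalCount n k d := by
  simp [totalMean, totalCount, meanCut_plantedAt_empty]
  ring

lemma totalMean_const_mul (c : ℝ) (φ : ℕ → ℝ) (n d : ℕ) (J : Finset (Fin k)) :
    totalMean (fun m => c * φ m) n d J = c * totalMean φ n d J := by
  simp [totalMean, meanCut_const_mul, Finset.mul_sum]

lemma totalMean_nonneg {φ : ℕ → ℝ} (hφ : ∀ m, 0 ≤ φ m) (n d : ℕ) (J : Finset (Fin k)) :
    0 ≤ totalMean φ n d J :=
  Finset.sum_nonneg fun _ _ => Finset.sum_nonneg fun _ _ => meanCut_nonneg hφ _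

lemma abs_cutError_le [NeZero n] {φ : ℕ → ℝ} (h0 : ∀ m, 0 ≤ φ m) (h1 : ∀ m, φ m ≤ 1) (d : ℕ)
    (J : Finset (Fin k)) (j : Fin k) :
    |cutError φ n d J j| ≤ (k : ℝ) / n * totalCount n k d := by
  have hn : (0 : ℝ) < n := Nat.cast_pos.2 (Nat.pos_of_ne_zero (NeZero.ne n))
  have hb : ∀ (ψ : ℕ → ℝ), (∀ m, 0 ≤ ψ m) → (∀ m, ψ m ≤ 1) → ∀ G : SimpleGraph (Fin n ⊕ Fin k),
      0 ≤ meanCut ψ G ∧ meanCut ψ G ≤ 1 := by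
    intro ψ hψ0 hψ1 G
    refine ⟨meanCut_nonneg hψ0 G, ?_⟩
    rw [← meanCut_const 1 G]
    exact meanCut_mono hψ1 G
  have hi : ∀ i ∈ J.erase j, |∑ p ∈ rootedForests n d, ∑ S : Fin k → Fin n,
      if S j ∈ p.2 ∧ S i ∈ comp p.1 (S j) then
        meanCut (fun m => φ (m + 1)) (plantedAt p.1 S (J.erase i)) - meanCut φ (plantedAt p.1 S J)
      else 0| ≤ totalCount n k d / n := by
    intro i hi
    have hsum := sum_ite_mem_comp (n := n) d (Finset.ne_of_mem_erase hi) (fun _ _ => 1)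
      (fun _ _ _ => rfl)
    have hcount : ∑ p ∈ rootedForests n d, ∑ S : Fin k → Fin n, (1 : ℝ) = totalCount n k d := by
      simp [totalCount]
    rw [hcount] at hsum
    rw [← hsum]
    refine (Finset.abs_sum_le_sum_abs _ _).trans (Finset.sum_le_sum fun p _ => ?_)
    refine (Finset.abs_sum_le_sum_abs _ _).trans (Finset.sum_le_sum fun S _ => ?_)
    split_ifs
    · obtain ⟨h2, h3⟩ := hb (fun m => φ (m + 1)) (fun m => h0 _) (fun m => h1 _)
        (plantedAt p.1 S (J.erase i))
      obtain ⟨h4, h5⟩ := hb φ h0 h1 (plantedAt p.1 S J)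
      rw [abs_le]
      constructor <;> linarith
    · simp
  have hcard : ((J.erase j).card : ℝ) ≤ k := by
    have := Finset.card_le_univ (J.erase j)
    rw [Fintype.card_fin] at this
    exact_mod_cast this
  calc |cutError φ n d J j| ≤ ∑ _i ∈ J.erase j, totalCount n k d / n :=
        (Finset.abs_sum_le_sum_abs _ _).trans (Finset.sum_le_sum hi)
    _ = (J.erase j).card * (totalCount n k d / n) := by simp
    _ ≤ k * (totalCount n k d / n) :=
        mul_le_mul_of_nonneg_right hcard (div_nonneg (totalCount_nonneg _ _ _) hn.le)
    _ = (k : ℝ) / n * totalCount n k d := by ring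

lemma cutError_le [NeZero n] {φ : ℕ → ℝ} (h0 : ∀ m, 0 ≤ φ m) (d : ℕ)
    (J : Finset (Fin k)) (j : Fin k) :
    cutError φ n d J j ≤
      ∑ i ∈ J.erase j, totalMean (fun m => φ (m + 1)) n d (J.erase i) / n := by
  refine Finset.sum_le_sum fun i hi => ?_
  have hsum := sum_ite_mem_comp (n := n) d (Finset.ne_of_mem_erase hi)
    (fun F S => meanCut (fun m => φ (m + 1)) (plantedAt F S (J.erase i)))
    (fun F S v => by rw [plantedAt_update_of_notMem (Finset.notMem_erase i J)])
  rw [totalMean, ← hsum]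
  refine Finset.sum_le_sum fun p _ => Finset.sum_le_sum fun S _ => ?_
  split_ifs
  · linarith [meanCut_nonneg h0 (plantedAt p.1 S J)]
  · exact le_rfl

end Recursion

/-! ### Poisson probabilities -/

section Poisson

/-- The probability that a Poisson variable of mean `x` equals `q`. -/
noncomputable def poissonTerm (q : ℕ) (x : ℝ) : ℝ := Real.exp (-x) * x ^ q / q.factorial

/-- The probability that a Poisson variable of mean `x` is less than `q`. -/
noncomputable def poissonLT (q : ℕ) (x : ℝ) : ℝ := ∑ j ∈ Finset.range q, poissonTerm j x

lemma poissonTerm_nonneg (q : ℕ) {x : ℝ} (hx : 0 ≤ x) : 0 ≤ poissonTerm q x := by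
  unfold poissonTerm; positivity

lemma poissonLT_succ (q : ℕ) (x : ℝ) : poissonLT (q + 1) x = poissonLT q x + poissonTerm q x :=
  Finset.sum_range_succ _ _

lemma poissonLT_zero_left (x : ℝ) : poissonLT 0 x = 0 := by simp [poissonLT]

lemma poissonLT_nonneg (q : ℕ) {x : ℝ} (hx : 0 ≤ x) : 0 ≤ poissonLT q x :=
  Finset.sum_nonneg fun _ _ => poissonTerm_nonneg _ hx

lemma poissonLT_le_one (q : ℕ) {x : ℝ} (hx : 0 ≤ x) : poissonLT q x ≤ 1 := by
  have h : poissonLT q x = Real.exp (-x) * ∑ j ∈ Finset.range q, x ^ j / j.factorial := by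
    rw [poissonLT, Finset.mul_sum]
    exact Finset.sum_congr rfl fun j _ => by rw [poissonTerm, mul_div_assoc]
  rw [h]
  calc _ ≤ Real.exp (-x) * Real.exp x :=
        mul_le_mul_of_nonneg_left (Real.sum_le_exp_of_nonneg hx q) (Real.exp_nonneg _)
    _ = 1 := by rw [← Real.exp_add]; simp

lemma poissonTerm_le_one (q : ℕ) {x : ℝ} (hx : 0 ≤ x) : poissonTerm q x ≤ 1 := by
  have h1 := poissonLT_succ q x
  have h2 := poissonLT_le_one (q + 1) hx
  have h3 := poissonLT_nonneg q hx
  linarith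

lemma poissonLT_succ_zero (q : ℕ) : poissonLT (q + 1) 0 = 1 := by
  rw [poissonLT, Finset.sum_range_succ']
  simp [poissonTerm]

lemma exp_neg_le_poissonLT (q : ℕ) {x : ℝ} (hx : 0 ≤ x) :
    Real.exp (-x) ≤ poissonLT (q + 1) x := by
  rw [poissonLT, Finset.sum_range_succ']
  have : 0 ≤ ∑ j ∈ Finset.range q, poissonTerm (j + 1) x :=
    Finset.sum_nonneg fun _ _ => poissonTerm_nonneg _ hx
  simp only [poissonTerm, pow_zero, Nat.factorial_zero, Nat.cast_one, mul_one, div_one] at this ⊢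
  linarith

lemma hasDerivAt_poissonTerm_zero (x : ℝ) :
    HasDerivAt (poissonTerm 0) (-poissonTerm 0 x) x := by
  have h : HasDerivAt (fun x : ℝ => Real.exp (-x)) (-Real.exp (-x)) x := by
    simpa using (hasDerivAt_neg x).exp
  have e : poissonTerm 0 = fun x : ℝ => Real.exp (-x) := by
    ext y; simp [poissonTerm]
  rw [e]
  exact h

lemma hasDerivAt_poissonTerm_succ (q : ℕ) (x : ℝ) :
    HasDerivAt (poissonTerm (q + 1)) (poissonTerm q x - poissonTerm (q + 1) x) x := by
  have h : HasDerivAt (fun x : ℝ => Real.exp (-x)) (-Real.exp (-x)) x := by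
    simpa using (hasDerivAt_neg x).exp
  have h2 := (h.mul (hasDerivAt_pow (q + 1) x)).div_const ((q + 1).factorial : ℝ)
  refine h2.congr_deriv ?_
  simp only [poissonTerm, Nat.factorial_succ]
  have : (q.factorial : ℝ) ≠ 0 := by positivity
  push_cast
  field_simp
  ring

lemma hasDerivAt_poissonLT_succ (q : ℕ) (x : ℝ) :
    HasDerivAt (poissonLT (q + 1)) (-poissonTerm q x) x := by
  induction q with
  | zero =>
    have e : poissonLT 1 = poissonTerm 0 := by ext y; simp [poissonLT]
    rw [e]
    exact hasDerivAt_poissonTerm_zero x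
  | succ q ih =>
    have e : poissonLT (q + 1 + 1) = fun y => poissonLT (q + 1) y + poissonTerm (q + 1) y := by
      ext y; exact poissonLT_succ _ _
    rw [e]
    exact (ih.add (hasDerivAt_poissonTerm_succ q x)).congr_deriv (by ring)

lemma abs_poissonTerm_sub_le (q : ℕ) {x y : ℝ} (hx : 0 ≤ x) (hy : 0 ≤ y) :
    |poissonTerm q y - poissonTerm q x| ≤ |y - x| := by
  have hd : ∀ z, ∃ D, HasDerivAt (poissonTerm q) D z ∧ (0 ≤ z → |D| ≤ 1) := by
    intro z
    rcases q with _ | q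
    · refine ⟨_, hasDerivAt_poissonTerm_zero z, fun hz => ?_⟩
      rw [abs_neg, abs_of_nonneg (poissonTerm_nonneg 0 hz)]
      exact poissonTerm_le_one 0 hz
    · refine ⟨_, hasDerivAt_poissonTerm_succ q z, fun hz => ?_⟩
      have h1 := poissonTerm_nonneg q hz
      have h2 := poissonTerm_nonneg (q + 1) hz
      have h3 := poissonTerm_le_one q hz
      have h4 := poissonTerm_le_one (q + 1) hz
      rw [abs_le]
      constructor <;> linarith
  choose D hD hD1 using hd
  have := (convex_Ici (0 : ℝ)).norm_image_sub_le_of_norm_hasDerivWithin_le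
    (f := poissonTerm q) (f' := D) (C := 1) (fun z _ => (hD z).hasDerivWithinAt)
    (fun z hz => by simpa using hD1 z hz) hx hy
  simpa using this

lemma abs_poissonLT_sub_le (q : ℕ) {x y : ℝ} (hx : 0 ≤ x) (hy : 0 ≤ y) :
    |poissonLT q y - poissonLT q x| ≤ |y - x| := by
  rcases q with _ | q
  · simp [poissonLT_zero_left]
  have := (convex_Ici (0 : ℝ)).norm_image_sub_le_of_norm_hasDerivWithin_le
    (f := poissonLT (q + 1)) (f' := fun z => -poissonTerm q z) (C := 1)
    (fun z _ => (hasDerivAt_poissonLT_succ q z).hasDerivWithinAt)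
    (fun z hz => by
      rw [norm_neg, Real.norm_eq_abs, abs_of_nonneg (poissonTerm_nonneg q hz)]
      exact poissonTerm_le_one q hz) hx hy
  simpa using this

lemma abs_poissonLT_taylor (q : ℕ) {x δ : ℝ} (hx : 0 ≤ x) (hδ : 0 ≤ δ) :
    |poissonLT (q + 1) (x + δ) - poissonLT (q + 1) x + δ * poissonTerm q x| ≤ δ ^ 2 := by
  have := (convex_Icc x (x + δ)).norm_image_sub_le_of_norm_hasDerivWithin_le
    (f := fun z => poissonLT (q + 1) z + z * poissonTerm q x)
    (f' := fun z => -poissonTerm q z + 1 * poissonTerm q x) (C := δ)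
    (fun z _ => ((hasDerivAt_poissonLT_succ q z).add
      ((hasDerivAt_id z).mul_const (poissonTerm q x))).hasDerivWithinAt)
    (fun z hz => by
      have h1 := abs_poissonTerm_sub_le q (hx.trans hz.1) hx
      have h2 : |x - z| ≤ δ := by
        rw [abs_le]; constructor <;> linarith [hz.1, hz.2]
      rw [Real.norm_eq_abs, one_mul, neg_add_eq_sub]
      exact h1.trans h2)
    (Set.left_mem_Icc.2 (by linarith)) (Set.right_mem_Icc.2 (by linarith))
  have e1 : x + δ - x = δ := by ring
  rw [e1, Real.norm_eq_abs, Real.norm_eq_abs, abs_of_nonneg hδ] at this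
  rw [sq]
  convert this using 2
  ring

lemma strictAntiOn_poissonLT (q : ℕ) : StrictAntiOn (poissonLT (q + 1)) (Set.Ici 0) := by
  refine strictAntiOn_of_deriv_neg (convex_Ici 0)
    (fun x _ => (hasDerivAt_poissonLT_succ q x).continuousAt.continuousWithinAt) fun x hx => ?_
  rw [interior_Ici] at hx
  have hx : 0 < x := hx
  rw [(hasDerivAt_poissonLT_succ q x).deriv, poissonTerm]
  have : 0 < Real.exp (-x) * x ^ q / q.factorial := by positivity
  linarith

lemma tendsto_poissonLT_atTop (q : ℕ) : Tendsto (poissonLT q) atTop (𝓝 0) := by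
  have : ∀ j, Tendsto (poissonTerm j) atTop (𝓝 0) := by
    intro j
    have := (Real.tendsto_pow_mul_exp_neg_atTop_nhds_zero j).div_const (j.factorial : ℝ)
    rw [zero_div] at this
    refine this.congr fun x => ?_
    rw [poissonTerm, mul_comm]
  have h := tendsto_finsetSum (Finset.range q) fun j _ => this j
  rw [Finset.sum_const_zero] at h
  exact h

end Poisson

/-! ### The tail of the number of cuts -/

section Tail

variable {n k : ℕ}

/-- The approximate mean number of repeats among `s` further samples, when `d` of the `n` values
have already been seen and nearly all the samples are new. -/
noncomputable def meanRepeats (n d s : ℕ) : ℝ := (s * d + (s : ℝ) ^ 2 / 2) / n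

lemma meanRepeats_nonneg (n d s : ℕ) : 0 ≤ meanRepeats n d s := by
  unfold meanRepeats; positivity

/-- The Poisson probabilities satisfy the recursion for the chain of repeats up to an error of
order `1 / n`. -/
lemma abs_poissonLT_sub_recursion_le [NeZero n] (q d s : ℕ) {Y : ℝ} (hY : 1 ≤ Y)
    (hd : (d : ℝ) ≤ Y) (hs : (s : ℝ) ≤ Y) :
    |((n : ℝ) - d) / n * poissonLT (q + 1) (meanRepeats n (d + 1) s) +
      d / n * poissonLT q (meanRepeats n d s) - poissonLT (q + 1) (meanRepeats n d (s + 1))| ≤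
      (5 * Y ^ 2 / n + 1) / n := by
  have hn : (0 : ℝ) < n := Nat.cast_pos.2 (Nat.pos_of_ne_zero (NeZero.ne n))
  set a := meanRepeats n (d + 1) s with ha
  set b := meanRepeats n d s with hb
  set δ : ℝ := (d + 1 / 2) / n with hδ
  have ha0 : 0 ≤ a := meanRepeats_nonneg _ _ _
  have hb0 : 0 ≤ b := meanRepeats_nonneg _ _ _
  have hδ0 : 0 ≤ δ := by positivity
  have h1 : meanRepeats n d (s + 1) = a + δ := by
    simp only [ha, hδ, meanRepeats]
    push_cast
    field_simp
    ring
  have h2 : b - a = -(s / n) := by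
    simp only [ha, hb, meanRepeats]
    push_cast
    field_simp
    ring
  have t1 := abs_poissonLT_taylor q ha0 hδ0
  have t2 := abs_poissonLT_sub_le q ha0 hb0
  rw [h2, abs_neg, abs_of_nonneg (by positivity : (0 : ℝ) ≤ s / n)] at t2
  have t3 := poissonLT_succ q a
  have t4 := poissonTerm_nonneg q ha0
  have t5 := poissonTerm_le_one q ha0
  rw [h1]
  have key : ((n : ℝ) - d) / n * poissonLT (q + 1) a + d / n * poissonLT q b -
      poissonLT (q + 1) (a + δ) =
      -(poissonLT (q + 1) (a + δ) - poissonLT (q + 1) a + δ * poissonTerm q a) +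
        d / n * (poissonLT q b - poissonLT q a) + 1 / (2 * n) * poissonTerm q a := by
    rw [t3]
    simp only [hδ]
    field_simp
    ring
  have u1 : δ ^ 2 ≤ 4 * Y ^ 2 / n / n := by
    rw [hδ, div_pow, div_div, ← sq]
    refine div_le_div_of_nonneg_right ?_ (by positivity)
    nlinarith [Nat.cast_nonneg (α := ℝ) d]
  have u2 : |(d : ℝ) / n * (poissonLT q b - poissonLT q a)| ≤ Y ^ 2 / n / n := by
    rw [abs_mul, abs_of_nonneg (by positivity : (0 : ℝ) ≤ d / n)]
    calc (d : ℝ) / n * |poissonLT q b - poissonLT q a| ≤ Y / n * (Y / n) := by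
          refine mul_le_mul ?_ (t2.trans ?_) (abs_nonneg _) (by positivity) <;>
          exact div_le_div_of_nonneg_right ‹_› hn.le
      _ = Y ^ 2 / n / n := by rw [div_mul_div_comm, div_div, sq]
  have u3 : |1 / (2 * (n : ℝ)) * poissonTerm q a| ≤ 1 / n := by
    rw [abs_of_nonneg (by positivity)]
    calc 1 / (2 * (n : ℝ)) * poissonTerm q a ≤ 1 / (2 * n) * 1 :=
          mul_le_mul_of_nonneg_left t5 (by positivity)
      _ ≤ 1 / n := by
          rw [mul_one]
          exact one_div_le_one_div_of_le hn (by linarith)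
  rw [key]
  calc _ ≤ |-(poissonLT (q + 1) (a + δ) - poissonLT (q + 1) a + δ * poissonTerm q a)| +
        |(d : ℝ) / n * (poissonLT q b - poissonLT q a)| + |1 / (2 * (n : ℝ)) * poissonTerm q a| :=
        abs_add_three _ _ _
    _ ≤ 4 * Y ^ 2 / n / n + Y ^ 2 / n / n + 1 / n := by
        rw [abs_neg]
        exact add_le_add (add_le_add (t1.trans u1) u2) u3
    _ = (5 * Y ^ 2 / n + 1) / n := by ring

/-- The indicator of `(s, ∞)`. -/
noncomputable def tailIndicator (s m : ℕ) : ℝ := if s < m then 1 else 0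

lemma tailIndicator_nonneg (s m : ℕ) : 0 ≤ tailIndicator s m := by
  unfold tailIndicator; split_ifs <;> norm_num

lemma tailIndicator_le_one (s m : ℕ) : tailIndicator s m ≤ 1 := by
  unfold tailIndicator; split_ifs <;> norm_num

/-- **Poisson approximation of the number of cuts.** In a uniform rooted forest with `d` trees, the
probability that more than `s` cuts are needed is close to the probability that a Poisson variable
is less than the number of planted nodes. The error terms of the recursion add up to `s` times a
quantity of order `1 / n`. -/
theorem abs_totalMean_tailIndicator_sub_le [NeZero n] {Y : ℝ} (s d : ℕ) (J : Finset (Fin k))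
    (hd : 1 ≤ d) (hY : (d : ℝ) + s ≤ Y) :
    |totalMean (tailIndicator s) n d J -
        poissonLT J.card (meanRepeats n d s) * totalCount n k d| ≤
      s * ((5 * Y ^ 2 / n + 1 + k) / n) * totalCount n k d := by
  have hn : (0 : ℝ) < n := Nat.cast_pos.2 (Nat.pos_of_ne_zero (NeZero.ne n))
  have hd' : (1 : ℝ) ≤ d := by exact_mod_cast hd
  induction s generalizing d J with
  | zero =>
    have h0 : meanRepeats n d 0 = 0 := by simp [meanRepeats]
    rw [h0]
    rcases J.eq_empty_or_nonempty with rfl | ⟨j, hj⟩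
    · rw [totalMean_empty]
      simp [poissonLT_zero_left, tailIndicator]
    · obtain ⟨q, hq⟩ : ∃ q, J.card = q + 1 :=
        Nat.exists_eq_succ_of_ne_zero (Finset.card_ne_zero_of_mem hj)
      rw [hq, poissonLT_succ_zero, one_mul]
      have : totalMean (tailIndicator 0) n d J = totalCount n k d := by
        rw [← one_mul (totalCount n k d), ← totalMean_const (1 : ℝ) n d J]
        refine Finset.sum_congr rfl fun p _ => Finset.sum_congr rfl fun S _ => ?_
        have hne : (activeFinset (plantedAt p.1 S J)).Nonempty := by
          refine ⟨s(Sum.inl (S j), Sum.inr j), mem_activeFinset.2 ⟨⟨hj, rfl⟩, j, fun v hv => ?_⟩⟩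
          rcases Sym2.mem_iff.1 hv with rfl | rfl
          · exact SimpleGraph.Adj.reachable ⟨hj, rfl⟩
          · rfl
        have hc : ((activeFinset (plantedAt p.1 S J)).card : ℝ) ≠ 0 := by simpa using hne.ne_empty
        apply mul_left_cancel₀ hc
        rw [card_mul_meanCut, card_mul_meanCut]
        simp [tailIndicator]
      rw [this]
      simp
  | succ s ih =>
    rcases J.eq_empty_or_nonempty with rfl | ⟨j, hj⟩
    · rw [totalMean_empty]
      simp only [tailIndicator, Finset.card_empty, poissonLT_zero_left]
      simp only [not_lt_zero, if_false, zero_mul, sub_zero, abs_zero]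
      have := totalCount_nonneg n k d
      positivity
    · obtain ⟨q, hq⟩ : ∃ q, J.card = q + 1 :=
        Nat.exists_eq_succ_of_ne_zero (Finset.card_ne_zero_of_mem hj)
      have hq' : (J.erase j).card = q := by rw [Finset.card_erase_of_mem hj, hq, Nat.add_sub_cancel]
      have hshift : (fun m => tailIndicator (s + 1) (m + 1)) = tailIndicator s := by
        ext m; simp [tailIndicator]
      have hrec := totalMean_eq (n := n) (tailIndicator (s + 1)) d hj
      rw [hshift] at hrec
      push_cast at hY
      have hs0 : (0 : ℝ) ≤ s := Nat.cast_nonneg s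
      have ih1 := ih (d + 1) J (by omega) (by push_cast; linarith) (by push_cast; linarith)
      have ih2 := ih d (J.erase j) hd (by linarith) hd'
      have herr := abs_cutError_le (n := n) (tailIndicator_nonneg (s + 1))
        (tailIndicator_le_one (s + 1)) d J j
      have hloc := abs_poissonLT_sub_recursion_le (n := n) q d s (Y := Y) (by linarith)
        (by linarith) (by linarith)
      rw [hq] at ih1
      rw [hq'] at ih2
      rw [hq, hrec]
      set T := totalCount n k d with hT
      set T' := totalCount n k (d + 1) with hT'
      have hT0 : 0 ≤ T := totalCount_nonneg _ _ _
      have hTT : d * T' = T * ((n - d) / n) := by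
        have := totalCount_succ n k d
        rw [← mul_div_assoc, eq_div_iff hn.ne']
        exact this
      set ε : ℝ := (5 * Y ^ 2 / n + 1 + k) / n with hε
      set A := totalMean (tailIndicator s) n (d + 1) J with hA
      set B := totalMean (tailIndicator s) n d (J.erase j) with hB
      set α := poissonLT (q + 1) (meanRepeats n (d + 1) s) with hα
      set β := poissonLT q (meanRepeats n d s) with hβ
      set γ := poissonLT (q + 1) (meanRepeats n d (s + 1)) with hγ
      have e1 : |d * (A - α * T')| ≤ s * ε * (T * ((n - d) / n)) := by
        rw [abs_mul, abs_of_nonneg (by positivity : (0 : ℝ) ≤ d), ← hTT]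
        calc (d : ℝ) * |A - α * T'| ≤ d * (s * ε * T') :=
              mul_le_mul_of_nonneg_left ih1 (by positivity)
          _ = s * ε * (d * T') := by ring
      have e2 : |d / n * (B - β * T)| ≤ s * ε * (T * (d / n)) := by
        rw [abs_mul, abs_of_nonneg (by positivity : (0 : ℝ) ≤ d / n)]
        calc (d : ℝ) / n * |B - β * T| ≤ d / n * (s * ε * T) :=
              mul_le_mul_of_nonneg_left ih2 (by positivity)
          _ = s * ε * (T * (d / n)) := by ring
      have e3 : |((n - d) / n * α + d / n * β - γ) * T| ≤ (5 * Y ^ 2 / n + 1) / n * T := by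
        rw [abs_mul, abs_of_nonneg hT0]
        exact mul_le_mul_of_nonneg_right hloc hT0
      have key : d * A + d / n * B + cutError (tailIndicator (s + 1)) n d J j - γ * T =
          d * (A - α * T') + d / n * (B - β * T) + ((n - d) / n * α + d / n * β - γ) * T +
            cutError (tailIndicator (s + 1)) n d J j := by
        linear_combination α * hTT
      rw [key]
      refine (abs_add_le _ _).trans ((add_le_add (abs_add_three _ _ _) le_rfl).trans ?_)
      calc _ ≤ s * ε * (T * ((n - d) / n)) + s * ε * (T * (d / n)) +
            (5 * Y ^ 2 / n + 1) / n * T + k / n * T :=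
            add_le_add (add_le_add (add_le_add e1 e2) e3) herr
        _ = ((s + 1 : ℕ) : ℝ) * ε * T := by
            rw [hε]
            push_cast
            field_simp
            ring

end Tail

/-! ### An exponential moment -/

section ExpMoment

variable {n k : ℕ}

/-- The dependence on `d` of the bound for the exponential moment of `M / √n`, where `u = 1 / √n`.
It decays exponentially while `d` is small compared with `√n`, which offsets the growth of the
moment at each cut; it is constant once `d u ≥ k + 3`, when the repeats, of probability at least
`(k + 3) u`, offset that growth by themselves. -/
noncomputable def expWeight (k : ℕ) (u : ℝ) (d : ℕ) : ℝ := Real.exp (2 * max 0 (k + 3 - d * u))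

lemma one_le_expWeight (k : ℕ) (u : ℝ) (d : ℕ) : 1 ≤ expWeight k u d :=
  Real.one_le_exp (by positivity)

/-- `2 ^ q * expWeight k u d` is a supersolution of the recursion for the exponential moment. -/
lemma expWeight_recursion_le {u : ℝ} (hu : 0 < u) (hku : (k + 4) * u ≤ 1) (hn : (n : ℝ) * u ^ 2 = 1)
    {d q : ℕ} (hd : d ≤ n) (hq : q ≤ k) :
    Real.exp u * ((n - d) / n * (2 * expWeight k u (d + 1)) + (d + q) / n * expWeight k u d) ≤
      2 * expWeight k u d := by
  have hk0 : (0 : ℝ) ≤ k := Nat.cast_nonneg k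
  have hq0 : (0 : ℝ) ≤ q := Nat.cast_nonneg q
  have hqk : (q : ℝ) ≤ k := by exact_mod_cast hq
  have hd0 : (0 : ℝ) ≤ d := Nat.cast_nonneg d
  have hdn : (d : ℝ) ≤ n := by exact_mod_cast hd
  have hn0 : (0 : ℝ) < n := by
    by_contra h
    have : (n : ℝ) = 0 := le_antisymm (not_lt.1 h) (Nat.cast_nonneg n)
    rw [this] at hn
    simp at hn
  have hinv : ∀ x : ℝ, x / n = x * u ^ 2 := by
    intro x
    rw [div_eq_iff hn0.ne']
    linear_combination -x * hn
  have hdu : (d : ℝ) * u ^ 2 ≤ 1 := by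
    rw [← hn]; exact mul_le_mul_of_nonneg_right hdn (sq_nonneg u)
  have hku' : (k : ℝ) * u ≤ 1 := by nlinarith
  have hu4 : 4 * u ≤ 1 := by nlinarith
  have hnd : ((n : ℝ) - d) / n = 1 - d * u ^ 2 := by rw [hinv, sub_mul, hn]
  rw [hnd, hinv]
  set w := expWeight k u d with hw
  set w' := expWeight k u (d + 1) with hw'
  have hw1 : 1 ≤ w := one_le_expWeight _ _ _
  have e1 : Real.exp u * Real.exp (-u) = 1 := by rw [← Real.exp_add]; simp
  -- it suffices to compare the factor in parentheses with `2 * exp (-u) * w`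
  suffices h : (1 - (d : ℝ) * u ^ 2) * (2 * w') + (d + q) * u ^ 2 * w ≤ 2 * Real.exp (-u) * w by
    calc _ ≤ Real.exp u * (2 * Real.exp (-u) * w) :=
          mul_le_mul_of_nonneg_left h (Real.exp_nonneg _)
      _ = 2 * w := by linear_combination 2 * w * e1
  by_cases hcase : k + 2 ≤ d * u
  · have hww : w' ≤ w := by
      refine Real.exp_le_exp.2 (mul_le_mul_of_nonneg_left (max_le_max le_rfl ?_) (by norm_num))
      push_cast
      nlinarith
    have h1 : (1 - (d : ℝ) * u ^ 2) * (2 * w') ≤ (1 - (d : ℝ) * u ^ 2) * (2 * w) :=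
      mul_le_mul_of_nonneg_left (by linarith) (by linarith)
    have h2 : 1 - u ≤ Real.exp (-u) := by linarith [Real.add_one_le_exp (-u)]
    have h3 : 2 * (1 - (d : ℝ) * u ^ 2) + (d + q) * u ^ 2 ≤ 2 * (1 - u) := by
      have : (q : ℝ) * u ^ 2 ≤ k * u := mul_le_mul hqk (by nlinarith) (sq_nonneg u) hk0
      nlinarith
    nlinarith
  · have hww : w' = Real.exp (-(2 * u)) * w := by
      rw [hw, hw', expWeight, expWeight, ← Real.exp_add]
      push_cast
      rw [max_eq_right (by nlinarith), max_eq_right (by nlinarith)]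
      ring_nf
    have h2 : 1 / 2 ≤ Real.exp (-(2 * u)) := by linarith [Real.add_one_le_exp (-(2 * u))]
    have h3 : Real.exp (-(2 * u)) * (1 + u) ≤ Real.exp (-u) := by
      have : Real.exp (-(2 * u)) * Real.exp u = Real.exp (-u) := by
        rw [← Real.exp_add]; ring_nf
      rw [← this]
      exact mul_le_mul_of_nonneg_left (by linarith [Real.add_one_le_exp u]) (Real.exp_nonneg _)
    set E := Real.exp (-(2 * u)) with hE
    rw [hww]
    have h4 : (q : ℝ) * u ^ 2 ≤ u := by nlinarith
    have h5 : 2 * (1 - (d : ℝ) * u ^ 2) * E + (d + q) * u ^ 2 ≤ 2 * Real.exp (-u) := by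
      have : (0 : ℝ) ≤ d * u ^ 2 := by positivity
      nlinarith
    nlinarith

lemma totalMean_exp_le [NeZero n] {u : ℝ} (hu : 0 < u) (hku : (k + 4) * u ≤ 1)
    (hn : (n : ℝ) * u ^ 2 = 1) (d : ℕ) (J : Finset (Fin k)) :
    totalMean (fun m => Real.exp (u * m)) n d J ≤
      2 ^ J.card * expWeight k u d * totalCount n k d := by
  have hn0 : (0 : ℝ) < n := Nat.cast_pos.2 (Nat.pos_of_ne_zero (NeZero.ne n))
  induction hN : (n + 1 - d) + J.card using Nat.strong_induction_on generalizing d J with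
  | _ N ih =>
    rcases lt_or_ge n d with hd | hd
    · simp [totalMean, rootedForests_eq_empty hd, totalCount_eq_zero k hd]
    have hT0 := totalCount_nonneg n k d
    rcases J.eq_empty_or_nonempty with rfl | ⟨j, hj⟩
    · rw [totalMean_empty]
      simp only [CharP.cast_eq_zero, mul_zero, Real.exp_zero, Finset.card_empty, pow_zero, one_mul]
      exact le_mul_of_one_le_left hT0 (one_le_expWeight _ _ _)
    obtain ⟨q, hq⟩ : ∃ q, J.card = q + 1 :=
      Nat.exists_eq_succ_of_ne_zero (Finset.card_ne_zero_of_mem hj)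
    have hqk : q ≤ k := by
      have := Finset.card_le_univ J
      rw [Fintype.card_fin] at this
      omega
    have hshift : (fun m : ℕ => Real.exp (u * ((m + 1 : ℕ) : ℝ))) =
        fun m : ℕ => Real.exp u * Real.exp (u * m) := by
      ext m
      rw [← Real.exp_add]
      push_cast
      ring_nf
    have hrec := totalMean_eq (n := n) (fun m => Real.exp (u * m)) d hj
    have herr := cutError_le (n := n) (φ := fun m => Real.exp (u * m))
      (fun m => Real.exp_nonneg _) d J j
    simp only [hshift, totalMean_const_mul] at hrec herr
    have ih1 := ih (n + 1 - (d + 1) + J.card) (by omega) (d + 1) J rfl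
    have ih2 : ∀ i ∈ J, totalMean (fun m => Real.exp (u * m)) n d (J.erase i) ≤
        2 ^ q * expWeight k u d * totalCount n k d := by
      intro i hi
      have hc : (J.erase i).card = q := by
        rw [Finset.card_erase_of_mem hi, hq, Nat.add_sub_cancel]
      have := ih (n + 1 - d + (J.erase i).card) (by omega) d (J.erase i) rfl
      rwa [hc] at this
    have herr' : cutError (fun m => Real.exp (u * m)) n d J j ≤
        q * (Real.exp u * (2 ^ q * expWeight k u d * totalCount n k d) / n) := by
      refine herr.trans ?_
      calc _ ≤ ∑ _i ∈ J.erase j, Real.exp u * (2 ^ q * expWeight k u d * totalCount n k d) / n := by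
            refine Finset.sum_le_sum fun i hi => div_le_div_of_nonneg_right ?_ hn0.le
            exact mul_le_mul_of_nonneg_left (ih2 i (Finset.mem_of_mem_erase hi)) (Real.exp_nonneg _)
        _ = _ := by
            rw [Finset.sum_const, Finset.card_erase_of_mem hj, hq, Nat.add_sub_cancel, nsmul_eq_mul]
    rw [hrec, hq]
    rw [hq] at ih1
    have hloc := expWeight_recursion_le (k := k) hu hku hn hd hqk
    have hTT : d * totalCount n k (d + 1) = totalCount n k d * ((n - d) / n) := by
      have := totalCount_succ n k d
      rw [← mul_div_assoc, eq_div_iff hn0.ne']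
      exact this
    set T := totalCount n k d with hT
    set T' := totalCount n k (d + 1) with hT'
    set w := expWeight k u d with hw
    set w' := expWeight k u (d + 1) with hw'
    have b1 := mul_le_mul_of_nonneg_left (mul_le_mul_of_nonneg_left ih1 (Real.exp_nonneg u))
      (Nat.cast_nonneg (α := ℝ) d)
    have b2 := mul_le_mul_of_nonneg_left (mul_le_mul_of_nonneg_left (ih2 j hj) (Real.exp_nonneg u))
      (by positivity : (0 : ℝ) ≤ d / n)
    calc _ ≤ d * (Real.exp u * (2 ^ (q + 1) * w' * T')) +
          d / n * (Real.exp u * (2 ^ q * w * T)) + q * (Real.exp u * (2 ^ q * w * T) / n) :=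
          add_le_add (add_le_add b1 b2) herr'
      _ = 2 ^ q * T * (Real.exp u * ((n - d) / n * (2 * w') + (d + q) / n * w)) := by
          rw [show (d : ℝ) * (Real.exp u * (2 ^ (q + 1) * w' * T')) =
            Real.exp u * 2 ^ (q + 1) * w' * (d * T') by ring, hTT]
          ring
      _ ≤ 2 ^ q * T * (2 * w) := mul_le_mul_of_nonneg_left hloc (by positivity)
      _ = 2 ^ (q + 1) * w * T := by ring

end ExpMoment

/-! ### The law of the number of cuts -/

section Law

variable {n k : ℕ}

lemma isRootSet_of_isTree {t : SimpleGraph (Fin n)} (ht : t.IsTree) (r : Fin n) :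
    IsRootSet t {r} where
  exists_root v := ⟨r, Finset.mem_singleton_self r, ht.connected.preconnected v r⟩
  eq_of_reachable a ha b hb _ := by
    rw [Finset.mem_singleton.1 ha, Finset.mem_singleton.1 hb]

/-- A rooted forest with one tree is a rooted tree. -/
lemma sum_rootedForests_one (g : SimpleGraph (Fin n) → ℝ) :
    ∑ p ∈ rootedForests n 1, g p.1 = ∑ t : RootedTree n, g t.1.1 := by
  symm
  refine Finset.sum_bij (fun t _ => (t.1.1, {t.1.2})) ?_ ?_ ?_ (fun _ _ => rfl)
  · intro t _
    exact mem_rootedForests.2 ⟨t.2.isAcyclic, isRootSet_of_isTree t.2 _, by simp⟩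
  · intro t _ t' _ h
    rw [Prod.mk.injEq, Finset.singleton_inj] at h
    exact Subtype.ext (Prod.ext h.1 h.2)
  · rintro ⟨F, R⟩ hp
    obtain ⟨hF, hR, hc⟩ := mem_rootedForests.1 hp
    obtain ⟨r, rfl⟩ := Finset.card_eq_one.1 hc
    have hconn : F.Connected := by
      have hr : ∀ v, F.Reachable v r := by
        intro v
        obtain ⟨s, hs, h⟩ := hR.exists_root v
        rwa [Finset.mem_singleton.1 hs] at h
      have : Nonempty (Fin n) := ⟨r⟩
      exact ⟨fun u v => (hr u).trans (hr v).symm⟩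
    exact ⟨⟨(F, r), ⟨hconn, hF⟩⟩, Finset.mem_univ _, rfl⟩

lemma totalMean_one (φ : ℕ → ℝ) :
    totalMean φ n 1 (Finset.univ : Finset (Fin k)) =
      ∑ t : RootedTree n, ∑ S : Fin k → Fin n, meanCut φ (planting t.1.1 S) := by
  simp only [totalMean, plantedAt_univ]
  exact sum_rootedForests_one fun F => ∑ S : Fin k → Fin n, meanCut φ (planting F S)

lemma totalCount_one : totalCount n k 1 = Fintype.card (RootedTree n) * (n : ℝ) ^ k := by
  have := sum_rootedForests_one (n := n) fun _ => 1
  simp only [Finset.sum_const, nsmul_eq_mul, mul_one, Finset.card_univ] at this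
  rw [totalCount, this]

lemma totalCount_one_pos [NeZero n] : 0 < totalCount n k 1 := by
  have h1 : (0 : ℝ) < Fintype.card (RootedTree n) := Nat.cast_pos.2 Fintype.card_pos
  have h2 : (0 : ℝ) < n := Nat.cast_pos.2 (Nat.pos_of_ne_zero (NeZero.ne n))
  rw [totalCount_one]
  positivity

/-- The probability that `M(T_n, S_k) > s`. -/
noncomputable def cutTail (n k s : ℕ) : ℝ :=
  totalMean (tailIndicator s) n 1 (Finset.univ : Finset (Fin k)) / totalCount n k 1

lemma tsum_map {α β : Type*} (p : PMF α) (f : α → β) (g : β → ℝ≥0∞) :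
    ∑' b, (p.map f) b * g b = ∑' a, p a * g (f a) := by
  classical
  simp only [PMF.map_apply, ← ENNReal.tsum_mul_right]
  rw [ENNReal.tsum_comm]
  refine tsum_congr fun a => ?_
  rw [tsum_eq_single (f a)]
  · simp
  · intro b hb
    simp [hb]

lemma tsum_bind {α β : Type*} (p : PMF α) (f : α → PMF β) (g : β → ℝ≥0∞) :
    ∑' b, (p.bind f) b * g b = ∑' a, p a * ∑' b, f a b * g b := by
  simp only [PMF.bind_apply, ← ENNReal.tsum_mul_right, ← ENNReal.tsum_mul_left]
  rw [ENNReal.tsum_comm]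
  simp only [mul_assoc]

/-- The expectation of `φ M(T_n, S_k)` is an average over the rooted trees and the sequences of
nodes. -/
lemma tsum_plantedCutting [NeZero n] (φ : ℕ → ℝ) (hφ : ∀ m, 0 ≤ φ m) :
    ∑' o, plantedCutting n k o * ENNReal.ofReal (φ o.cutCount) =
      ENNReal.ofReal (totalMean φ n 1 (Finset.univ : Finset (Fin k)) / totalCount n k 1) := by
  have hn : (0 : ℝ) < n := Nat.cast_pos.2 (Nat.pos_of_ne_zero (NeZero.ne n))
  have hc : (0 : ℝ) < Fintype.card (RootedTree n) := Nat.cast_pos.2 Fintype.card_pos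
  have hS : ∀ t : RootedTree n, ∑' o : Outcome n k,
      ((PMF.uniformOfFintype (Fin k → Fin n)).bind fun S =>
        (cutSequence (planting t.1.1 S)).map fun e => (⟨t, S, e⟩ : Outcome n k)) o *
          ENNReal.ofReal (φ o.cutCount) =
      ENNReal.ofReal ((∑ S : Fin k → Fin n, meanCut φ (planting t.1.1 S)) / (n : ℝ) ^ k) := by
    intro t
    rw [tsum_bind, tsum_fintype, ENNReal.ofReal_div_of_pos (by positivity),
      ENNReal.ofReal_sum_of_nonneg fun S _ => meanCut_nonneg hφ _, ENNReal.div_eq_inv_mul,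
      Finset.mul_sum]
    refine Finset.sum_congr rfl fun S _ => ?_
    rw [tsum_map, PMF.uniformOfFintype_apply]
    simp only [Outcome.cutCount]
    rw [tsum_cutSequence φ hφ]
    congr 2
    rw [Fintype.card_fun, Fintype.card_fin, Fintype.card_fin, ENNReal.ofReal_pow hn.le,
      ENNReal.ofReal_natCast]
    push_cast
    rfl
  rw [plantedCutting, tsum_bind, tsum_fintype, totalMean_one, totalCount_one]
  simp only [hS]
  rw [mul_comm, ← div_div, Finset.sum_div, ENNReal.ofReal_div_of_pos hc,
    ENNReal.ofReal_sum_of_nonneg fun t _ => div_nonneg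
      (Finset.sum_nonneg fun S _ => meanCut_nonneg hφ _) (by positivity), ENNReal.div_eq_inv_mul,
    Finset.mul_sum]
  refine Finset.sum_congr rfl fun t _ => ?_
  rw [PMF.uniformOfFintype_apply, ENNReal.ofReal_natCast]

lemma toMeasure_cutCount [NeZero n] (s : ℕ) :
    (plantedCutting n k).toMeasure {o | s < o.cutCount} = ENNReal.ofReal (cutTail n k s) := by
  rw [cutTail, ← tsum_plantedCutting _ (tailIndicator_nonneg s),
    PMF.toMeasure_apply _ (MeasurableSpace.measurableSet_top : MeasurableSet[⊤] _)]
  refine tsum_congr fun o => ?_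
  by_cases h : s < o.cutCount <;> simp [tailIndicator, h]

lemma cutTail_nonneg (n k s : ℕ) : 0 ≤ cutTail n k s :=
  div_nonneg (totalMean_nonneg (tailIndicator_nonneg s) _ _ _) (totalCount_nonneg _ _ _)

lemma totalMean_mono {φ ψ : ℕ → ℝ} (h : ∀ m, φ m ≤ ψ m) (n d : ℕ) (J : Finset (Fin k)) :
    totalMean φ n d J ≤ totalMean ψ n d J :=
  Finset.sum_le_sum fun _ _ => Finset.sum_le_sum fun _ _ => meanCut_mono h _

lemma cutTail_le_one (n k s : ℕ) : cutTail n k s ≤ 1 := by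
  refine div_le_one_of_le₀ ?_ (totalCount_nonneg _ _ _)
  have := totalMean_mono (tailIndicator_le_one s) n 1 (Finset.univ : Finset (Fin k))
  rwa [totalMean_const, one_mul] at this

lemma cutTail_antitone (n k : ℕ) : Antitone (cutTail n k) := by
  intro s s' h
  refine div_le_div_of_nonneg_right (totalMean_mono (fun m => ?_) _ _ _) (totalCount_nonneg _ _ _)
  unfold tailIndicator
  split_ifs <;> first | omega | norm_num

lemma meanCut_tailIndicator_eq_zero {s : ℕ} (F : SimpleGraph (Fin n ⊕ Fin k))
    (h : F.edgeSet.ncard ≤ s) : meanCut (tailIndicator s) F = 0 := by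
  induction F using cut_induction generalizing s with
  | step F ih =>
    rcases (activeFinset F).eq_empty_or_nonempty with h0 | h0
    · rw [meanCut_of_activeFinset_eq_empty h0]
      simp [tailIndicator]
    · have hc : ((activeFinset F).card : ℝ) ≠ 0 := by simpa using h0.ne_empty
      apply mul_left_cancel₀ hc
      rw [card_mul_meanCut, mul_zero]
      refine Finset.sum_eq_zero fun e he => ?_
      have hlt := ncard_edgeSet_deleteEdges_lt (mem_activeFinset.1 he)
      obtain ⟨s, rfl⟩ : ∃ s', s = s' + 1 := Nat.exists_eq_succ_of_ne_zero (by omega)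
      have hshift : (fun m => tailIndicator (s + 1) (m + 1)) = tailIndicator s := by
        ext m; simp [tailIndicator]
      rw [hshift]
      exact ih e (mem_edgeSet_of_mem_activeFinset he) (by omega)

/-- The number of cuts is bounded by the number of pairs of nodes. -/
lemma cutTail_eq_zero (n k : ℕ) : cutTail n k (Fintype.card (Sym2 (Fin n ⊕ Fin k))) = 0 := by
  rw [cutTail, totalMean, Finset.sum_eq_zero, zero_div]
  refine fun p _ => Finset.sum_eq_zero fun S _ => meanCut_tailIndicator_eq_zero _ ?_
  rw [← Nat.card_eq_fintype_card]
  exact Set.ncard_le_card _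

/-- The tail of `M(T_n, S_k) / √n` decays exponentially, uniformly in `n`. -/
lemma cutTail_le_exp [NeZero n] (hn : ((k : ℝ) + 4) ^ 2 ≤ n) (s : ℕ) :
    cutTail n k s ≤ 2 ^ k * Real.exp (2 * (k + 3)) * Real.exp (-(s / √(n : ℝ))) := by
  have hn0 : (0 : ℝ) < n := Nat.cast_pos.2 (Nat.pos_of_ne_zero (NeZero.ne n))
  have hs : 0 < √(n : ℝ) := Real.sqrt_pos.2 hn0
  set u : ℝ := 1 / √(n : ℝ) with hu
  have hu0 : 0 < u := by positivity
  have hnu : (n : ℝ) * u ^ 2 = 1 := by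
    rw [hu, div_pow, Real.sq_sqrt hn0.le]
    field_simp
  have hku : (k + 4) * u ≤ 1 := by
    rw [hu, mul_one_div, div_le_one hs]
    exact Real.le_sqrt_of_sq_le hn
  have h1 := totalMean_exp_le (n := n) hu0 hku hnu 1 (Finset.univ : Finset (Fin k))
  have h2 : expWeight k u 1 ≤ Real.exp (2 * (k + 3)) := by
    refine Real.exp_le_exp.2 (mul_le_mul_of_nonneg_left (max_le (by positivity) ?_) (by norm_num))
    push_cast
    linarith
  rw [Finset.card_fin] at h1
  have hT : 0 < totalCount n k 1 := totalCount_one_pos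
  rw [cutTail, div_le_iff₀ hT]
  have h3 : totalMean (tailIndicator s) n 1 (Finset.univ : Finset (Fin k)) ≤
      totalMean (fun m => Real.exp (-(s / √(n : ℝ))) * Real.exp (u * m)) n 1
        (Finset.univ : Finset (Fin k)) := by
    refine totalMean_mono (fun m => ?_) _ _ _
    rw [← Real.exp_add]
    unfold tailIndicator
    split_ifs with h
    · refine Real.one_le_exp ?_
      have : (s : ℝ) ≤ m := by exact_mod_cast h.le
      have := mul_le_mul_of_nonneg_left this hu0.le
      rw [div_eq_mul_one_div, ← hu]
      linarith
    · positivity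
  rw [totalMean_const_mul] at h3
  calc _ ≤ _ := h3
    _ ≤ Real.exp (-(s / √(n : ℝ))) * (2 ^ k * expWeight k u 1 * totalCount n k 1) :=
        mul_le_mul_of_nonneg_left h1 (Real.exp_nonneg _)
    _ ≤ Real.exp (-(s / √(n : ℝ))) * (2 ^ k * Real.exp (2 * (k + 3)) * totalCount n k 1) := by
        gcongr
    _ = _ := by ring

/-- The tail of `M(T_n, S_k)` on the scale `√n`. -/
lemma tendsto_cutTail (k : ℕ) {y : ℝ} (hy : 0 ≤ y) :
    Tendsto (fun n : ℕ => cutTail (n + 1) k ⌊y * √((n + 1 : ℕ) : ℝ)⌋₊) atTop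
      (𝓝 (poissonLT k (y ^ 2 / 2))) := by
  set r : ℕ → ℝ := fun n => √((n + 1 : ℕ) : ℝ) with hr
  have hr0 : ∀ n, 0 < r n := fun n => Real.sqrt_pos.2 (by positivity)
  have hr1 : ∀ n, 1 ≤ r n := fun n => by
    rw [hr]
    exact Real.one_le_sqrt.2 (by push_cast; linarith [Nat.cast_nonneg (α := ℝ) n])
  have hrsq : ∀ n, ((n + 1 : ℕ) : ℝ) = r n ^ 2 := fun n => (Real.sq_sqrt (by positivity)).symm
  have hrtop : Tendsto r atTop atTop :=
    Real.tendsto_sqrt_atTop.comp (tendsto_natCast_atTop_atTop.comp (tendsto_add_atTop_nat 1))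
  have hrinv : Tendsto (fun n => (r n)⁻¹) atTop (𝓝 0) := tendsto_inv_atTop_zero.comp hrtop
  have hfl : Tendsto (fun n => (⌊y * r n⌋₊ : ℝ) / r n) atTop (𝓝 y) :=
    (tendsto_nat_floor_mul_div_atTop hy).comp hrtop
  have hmean : Tendsto (fun n => meanRepeats (n + 1) 1 ⌊y * r n⌋₊) atTop (𝓝 (y ^ 2 / 2)) := by
    have h := (hfl.mul hrinv).add ((hfl.pow 2).div_const 2)
    rw [mul_zero, zero_add] at h
    refine h.congr fun n => ?_
    rw [meanRepeats, hrsq n]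
    have := (hr0 n).ne'
    push_cast
    field_simp
  have hcont : Tendsto (fun n => poissonLT k (meanRepeats (n + 1) 1 ⌊y * r n⌋₊)) atTop
      (𝓝 (poissonLT k (y ^ 2 / 2))) := by
    rcases k with _ | k
    · simp only [poissonLT_zero_left]
      exact tendsto_const_nhds
    · exact ((hasDerivAt_poissonLT_succ k _).continuousAt.tendsto).comp hmean
  -- the number of steps is at most `(y + 1) √n` and each contributes an error of order `1 / n`
  set c : ℝ := (y + 1) * (5 * (y + 1) ^ 2 + 1 + k) with hc
  have hdiff : ∀ n : ℕ, |cutTail (n + 1) k ⌊y * r n⌋₊ -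
      poissonLT k (meanRepeats (n + 1) 1 ⌊y * r n⌋₊)| ≤ c * (r n)⁻¹ := by
    intro n
    have hs : (⌊y * r n⌋₊ : ℝ) ≤ y * r n := Nat.floor_le (mul_nonneg hy (hr0 n).le)
    have h := abs_totalMean_tailIndicator_sub_le (n := n + 1) (k := k) (Y := (y + 1) * r n)
      ⌊y * r n⌋₊ 1 Finset.univ le_rfl (by push_cast; linarith [hr1 n])
    rw [Finset.card_fin] at h
    have hT : 0 < totalCount (n + 1) k 1 := totalCount_one_pos
    rw [cutTail, div_sub' hT.ne', abs_div, abs_of_pos hT, div_le_iff₀ hT,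
      mul_comm (totalCount (n + 1) k 1)]
    refine h.trans (mul_le_mul_of_nonneg_right ?_ hT.le)
    have e : (5 * ((y + 1) * r n) ^ 2 / ((n + 1 : ℕ) : ℝ) + 1 + k) / ((n + 1 : ℕ) : ℝ) =
        (5 * (y + 1) ^ 2 + 1 + k) * (r n)⁻¹ ^ 2 := by
      rw [hrsq]
      have := (hr0 n).ne'
      field_simp
    rw [e]
    calc (⌊y * r n⌋₊ : ℝ) * ((5 * (y + 1) ^ 2 + 1 + k) * (r n)⁻¹ ^ 2)
        ≤ ((y + 1) * r n) * ((5 * (y + 1) ^ 2 + 1 + k) * (r n)⁻¹ ^ 2) := by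
          refine mul_le_mul_of_nonneg_right ?_ (by positivity)
          linarith [hr0 n]
      _ = c * (r n)⁻¹ := by
          have := (hr0 n).ne'
          rw [hc]
          field_simp
  have hzero : Tendsto (fun n => cutTail (n + 1) k ⌊y * r n⌋₊ -
      poissonLT k (meanRepeats (n + 1) 1 ⌊y * r n⌋₊)) atTop (𝓝 0) := by
    refine squeeze_zero_norm hdiff ?_
    simpa using hrinv.const_mul c
  have h := hzero.add hcont
  rw [zero_add] at h
  exact h.congr fun n => sub_add_cancel _ _

end Law

/-! ### The chi distribution -/

section Chi

variable {k : ℕ}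

lemma measurable_chiPDF (k : ℕ) : Measurable (chiPDF k) := by
  unfold chiPDF
  exact Measurable.ite measurableSet_Ici (by fun_prop) measurable_const

lemma chiPDF_nonneg (k : ℕ) (s : ℝ) : 0 ≤ chiPDF k s := by
  unfold chiPDF
  split_ifs <;> positivity

/-- The tail of the chi distribution with `2 k` degrees of freedom is a Poisson probability. -/
lemma chiMeasure_Ioi [NeZero k] {y : ℝ} (hy : 0 ≤ y) :
    chiMeasure k (Set.Ioi y) = ENNReal.ofReal (poissonLT k (y ^ 2 / 2)) := by
  obtain ⟨q, rfl⟩ : ∃ q, k = q + 1 := Nat.exists_eq_succ_of_ne_zero (NeZero.ne k)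
  have hderiv : ∀ x ∈ Set.Ici y,
      HasDerivAt (fun x : ℝ => -poissonLT (q + 1) (x ^ 2 / 2)) (chiPDF (q + 1) x) x := by
    intro x hx
    have hx0 : 0 ≤ x := hy.trans hx
    have h1 : HasDerivAt (fun x : ℝ => x ^ 2 / 2) x x := by
      refine ((hasDerivAt_pow 2 x).div_const 2).congr_deriv ?_
      simp
    refine (((hasDerivAt_poissonLT_succ q (x ^ 2 / 2)).comp x h1).neg).congr_deriv ?_
    rw [chiPDF, if_pos hx0, poissonTerm, Nat.add_sub_cancel,
      show 2 * (q + 1) - 1 = 2 * q + 1 by omega,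
      show 1 - ((q + 1 : ℕ) : ℤ) = -(q : ℤ) by push_cast; ring, zpow_neg, zpow_natCast, neg_div,
      div_pow, ← pow_mul, pow_succ]
    have : (q.factorial : ℝ) ≠ 0 := by positivity
    field_simp
    ring
  have hlim : Tendsto (fun x : ℝ => -poissonLT (q + 1) (x ^ 2 / 2)) atTop (𝓝 0) := by
    have h2 : Tendsto (fun x : ℝ => x ^ 2 / 2) atTop atTop :=
      (tendsto_pow_atTop two_ne_zero).atTop_div_const (by norm_num)
    simpa using ((tendsto_poissonLT_atTop (q + 1)).comp h2).neg
  have hint := integrableOn_Ioi_deriv_of_nonneg' hderiv (fun x _ => chiPDF_nonneg _ _) hlim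
  have hval := integral_Ioi_of_hasDerivAt_of_nonneg' hderiv (fun x _ => chiPDF_nonneg _ _) hlim
  rw [chiMeasure, withDensity_apply _ measurableSet_Ioi,
    ← ofReal_integral_eq_lintegral_ofReal hint (Eventually.of_forall fun x => chiPDF_nonneg _ _),
    hval, sub_neg_eq_add, zero_add]

lemma ae_chiMeasure_pos [NeZero k] : ∀ᵐ ω ∂chiMeasure k, 0 < ω := by
  have h : chiMeasure k (Set.Ioi 0) = 1 := by
    obtain ⟨q, rfl⟩ : ∃ q, k = q + 1 := Nat.exists_eq_succ_of_ne_zero (NeZero.ne k)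
    rw [chiMeasure_Ioi le_rfl]
    simp [poissonLT_succ_zero]
  rw [← prob_compl_eq_zero_iff measurableSet_Ioi] at h
  exact h

lemma strictAntiOn_chiTail [NeZero k] :
    StrictAntiOn (fun y : ℝ => poissonLT k (y ^ 2 / 2)) (Set.Ici 0) := by
  obtain ⟨q, rfl⟩ : ∃ q, k = q + 1 := Nat.exists_eq_succ_of_ne_zero (NeZero.ne k)
  intro x hx y hy hxy
  have hx : 0 ≤ x := hx
  exact strictAntiOn_poissonLT q (Set.mem_Ici.2 (by positivity)) (Set.mem_Ici.2 (by positivity))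
    (by nlinarith)

lemma continuous_chiTail (k : ℕ) : Continuous fun y : ℝ => poissonLT k (y ^ 2 / 2) := by
  unfold poissonLT poissonTerm
  fun_prop

/-- The tail function evaluated at a chi random variable is uniform on `(0, 1)`. -/
lemma chiMeasure_chiTail_lt [NeZero k] {s : ℝ} (h0 : 0 ≤ s) (h1 : s ≤ 1) :
    chiMeasure k {ω | poissonLT k (ω ^ 2 / 2) < s} = ENNReal.ofReal s := by
  rcases h0.eq_or_lt with rfl | h0
  · rw [ENNReal.ofReal_zero, measure_eq_zero_iff_ae_notMem]
    exact Eventually.of_forall fun ω hω =>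
      (not_lt.2 (poissonLT_nonneg k (by positivity : (0 : ℝ) ≤ ω ^ 2 / 2))) hω
  obtain ⟨y, hy, hys⟩ : ∃ y, 0 ≤ y ∧ poissonLT k (y ^ 2 / 2) = s := by
    have h2 : Tendsto (fun x : ℝ => x ^ 2 / 2) atTop atTop :=
      (tendsto_pow_atTop two_ne_zero).atTop_div_const (by norm_num)
    have hev := ((tendsto_poissonLT_atTop k).comp h2).eventually (gt_mem_nhds h0)
    obtain ⟨b, hb, hb0⟩ := (hev.and (eventually_ge_atTop 0)).exists
    have hz : poissonLT k ((0 : ℝ) ^ 2 / 2) = 1 := by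
      obtain ⟨q, rfl⟩ : ∃ q, k = q + 1 := Nat.exists_eq_succ_of_ne_zero (NeZero.ne k)
      simp [poissonLT_succ_zero]
    have hmem : s ∈ Set.Icc (poissonLT k (b ^ 2 / 2)) (poissonLT k ((0 : ℝ) ^ 2 / 2)) :=
      ⟨le_of_lt hb, hz ▸ h1⟩
    obtain ⟨y, hy, hys⟩ := intermediate_value_Icc' hb0 (continuous_chiTail k).continuousOn hmem
    exact ⟨y, hy.1, hys⟩
  rw [← hys, ← chiMeasure_Ioi hy]
  refine measure_congr ?_
  filter_upwards [ae_chiMeasure_pos (k := k)] with ω hω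
  exact propext (strictAntiOn_chiTail.lt_iff_gt (Set.mem_Ici.2 hω.le) (Set.mem_Ici.2 hy))

lemma memLp_sq_chiMeasure [NeZero k] {p : ℝ≥0∞} (hp : p ≠ ∞) :
    MemLp (fun ω : ℝ => ω ^ 2) p (chiMeasure k) := by
  obtain ⟨q, rfl⟩ : ∃ q, k = q + 1 := Nat.exists_eq_succ_of_ne_zero (NeZero.ne k)
  set N : ℕ := ⌈p.toReal⌉₊ + 1 with hN
  have hpN : p ≤ (N : ℝ≥0∞) := by
    rw [← ENNReal.ofReal_toReal hp, ← ENNReal.ofReal_natCast]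
    refine ENNReal.ofReal_le_ofReal ((Nat.le_ceil _).trans ?_)
    rw [hN]; push_cast; linarith
  refine MemLp.mono_exponent (q := (N : ℝ≥0∞)) ?_ hpN
  refine ⟨by fun_prop, ?_⟩
  rw [eLpNorm_lt_top_iff_lintegral_rpow_enorm_lt_top (by simp [hN]) (ENNReal.natCast_ne_top N),
    chiMeasure, lintegral_withDensity_eq_lintegral_mul _
      (measurable_chiPDF _).ennreal_ofReal (by fun_prop)]
  have hint : IntegrableOn (fun x : ℝ => x ^ ((2 * N + (2 * q + 1) : ℕ) : ℝ) *
      Real.exp (-(1 / 2) * x ^ 2)) (Set.Ioi 0) :=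
    integrableOn_rpow_mul_exp_neg_mul_sq (by norm_num)
      (lt_of_lt_of_le (by norm_num) (Nat.cast_nonneg _))
  set c : ℝ := (2 : ℝ) ^ (1 - ((q + 1 : ℕ) : ℤ)) / (q.factorial : ℝ) with hc
  have hfin := (hint.const_mul c).lintegral_lt_top
  rw [← lintegral_add_compl _ (measurableSet_Iic (a := (0 : ℝ))), Set.compl_Iic,
    setLIntegral_congr_fun (g := fun _ => 0) measurableSet_Iic, lintegral_zero, zero_add]
  · refine lt_of_le_of_lt (le_of_eq ?_) hfin
    refine setLIntegral_congr_fun measurableSet_Ioi fun x hx => ?_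
    have hx0 : (0 : ℝ) < x := hx
    have e1 : ‖x ^ 2‖ₑ ^ ((N : ℝ≥0∞)).toReal = ENNReal.ofReal (x ^ (2 * N)) := by
      rw [ENNReal.toReal_natCast, ENNReal.rpow_natCast, Real.enorm_eq_ofReal (by positivity),
        ← ENNReal.ofReal_pow (by positivity), ← pow_mul]
    simp only [Pi.mul_apply]
    rw [e1, ← ENNReal.ofReal_mul (chiPDF_nonneg _ _), chiPDF, if_pos hx0.le, Nat.add_sub_cancel,
      show 2 * (q + 1) - 1 = 2 * q + 1 by omega, Real.rpow_natCast, pow_add, hc,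
      show -(1 / 2) * x ^ 2 = -x ^ 2 / 2 by ring]
    congr 1
    ring
  · intro x hx
    have hx0 : x ≤ 0 := hx
    have : chiPDF (q + 1) x = 0 := by
      rcases hx0.lt_or_eq with h | h
      · simp [chiPDF, not_le.2 h]
      · simp [chiPDF, h, show 2 * (q + 1) - 1 ≠ 0 by omega]
    simp [this]

end Chi

/-! ### The coupling -/

section Coupling

variable {n k : ℕ}

/-- The number of cuts as a function of a chi random variable `ω`: the quantile transform at the
uniform variable `poissonLT k (ω ^ 2 / 2)`. -/
noncomputable def coupledCuts (n k : ℕ) (ω : ℝ) : ℕ :=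
  sInf {m | cutTail n k m ≤ poissonLT k (ω ^ 2 / 2)}

lemma lt_coupledCuts_iff {s : ℕ} {ω : ℝ} :
    s < coupledCuts n k ω ↔ poissonLT k (ω ^ 2 / 2) < cutTail n k s := by
  constructor
  · intro h
    exact not_le.1 (Nat.notMem_of_lt_sInf h)
  · intro h
    by_contra hs
    have hne : {m | cutTail n k m ≤ poissonLT k (ω ^ 2 / 2)}.Nonempty :=
      ⟨_, (cutTail_eq_zero n k).le.trans (poissonLT_nonneg k (by positivity))⟩
    have h1 : cutTail n k (coupledCuts n k ω) ≤ poissonLT k (ω ^ 2 / 2) := Nat.sInf_mem hne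
    have h2 := cutTail_antitone n k (not_lt.1 hs)
    linarith

lemma measurable_coupledCuts (n k : ℕ) : Measurable (coupledCuts n k) := by
  refine measurable_of_Ioi fun s => ?_
  have : coupledCuts n k ⁻¹' Set.Ioi s = {ω | poissonLT k (ω ^ 2 / 2) < cutTail n k s} := by
    ext ω
    exact lt_coupledCuts_iff
  rw [this]
  exact measurableSet_lt (continuous_chiTail k).measurable measurable_const

lemma measurable_of_outcome {α : Type*} [MeasurableSpace α] (f : Outcome n k → α) :
    Measurable f := fun _ _ => MeasurableSpace.measurableSet_top

lemma map_coupledCuts [NeZero n] [NeZero k] :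
    (chiMeasure k).map (coupledCuts n k) =
      (plantedCutting n k).toMeasure.map Outcome.cutCount := by
  have hm := measurable_coupledCuts n k
  have hm' : Measurable (Outcome.cutCount : Outcome n k → ℕ) := measurable_of_outcome _
  have : IsProbabilityMeasure ((chiMeasure k).map (coupledCuts n k)) :=
    Measure.isProbabilityMeasure_map hm.aemeasurable
  have : IsProbabilityMeasure ((plantedCutting n k).toMeasure.map Outcome.cutCount) :=
    Measure.isProbabilityMeasure_map hm'.aemeasurable
  refine Measure.ext_of_Iic _ _ fun s => ?_
  have hset : ∀ μ : Measure ℕ, IsProbabilityMeasure μ →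
      μ (Set.Iic s) = 1 - μ (Set.Ioi s) := by
    intro μ hμ
    rw [← Set.compl_Ioi, prob_compl_eq_one_sub measurableSet_Ioi]
  rw [hset _ inferInstance, hset _ inferInstance, Measure.map_apply hm measurableSet_Ioi,
    Measure.map_apply hm' measurableSet_Ioi]
  congr 1
  have e1 : coupledCuts n k ⁻¹' Set.Ioi s = {ω | poissonLT k (ω ^ 2 / 2) < cutTail n k s} := by
    ext ω
    exact lt_coupledCuts_iff
  rw [e1, chiMeasure_chiTail_lt (cutTail_nonneg _ _ _) (cutTail_le_one _ _ _)]
  exact (toMeasure_cutCount s).symm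

/-- The normalized number of cuts, on the probability space of the chi distribution. -/
noncomputable def coupledVar (k n : ℕ) (ω : ℝ) : ℝ :=
  (coupledCuts (n + 1) k ω : ℝ) / √((n + 1 : ℕ) : ℝ)

lemma measurable_coupledVar (k n : ℕ) : Measurable (coupledVar k n) :=
  ((measurable_from_nat (f := fun m : ℕ => (m : ℝ))).comp (measurable_coupledCuts _ _)).div_const _

lemma hasLaw_coupledVar [NeZero k] (n : ℕ) :
    HasLaw (coupledVar k n)
      ((plantedCutting (n + 1) k).toMeasure.map (normalizedCuts (n + 1) k)) (chiMeasure k) where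
  aemeasurable := (measurable_coupledVar k n).aemeasurable
  map_eq := by
    set f : ℕ → ℝ := fun m => (m : ℝ) / √((n + 1 : ℕ) : ℝ) with hf
    have hfm : Measurable f := measurable_from_nat
    have e1 : coupledVar k n = f ∘ coupledCuts (n + 1) k := rfl
    have e2 : normalizedCuts (n + 1) k = f ∘ Outcome.cutCount := rfl
    rw [e1, e2, ← Measure.map_map hfm (measurable_coupledCuts _ _),
      ← Measure.map_map hfm (measurable_of_outcome _), map_coupledCuts]

lemma sqrt_succ_pos (n : ℕ) : 0 < √((n + 1 : ℕ) : ℝ) := Real.sqrt_pos.2 (by positivity)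

lemma tendsto_coupledVar [NeZero k] {ω : ℝ} (hω : 0 < ω) :
    Tendsto (fun n => coupledVar k n ω) atTop (𝓝 ω) := by
  have hanti := strictAntiOn_chiTail (k := k)
  refine tendsto_order.2 ⟨fun a ha => ?_, fun b hb => ?_⟩
  · obtain ⟨y, hy1, hy2⟩ := exists_between (max_lt ha hω)
    have hy0 : 0 ≤ y := (le_max_right a 0).trans hy1.le
    have hG : poissonLT k (ω ^ 2 / 2) < poissonLT k (y ^ 2 / 2) :=
      hanti (Set.mem_Ici.2 hy0) (Set.mem_Ici.2 hω.le) hy2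
    filter_upwards [(tendsto_cutTail k hy0).eventually (lt_mem_nhds hG)] with n hn
    have h1 := lt_coupledCuts_iff.2 hn
    have h2 : y * √((n + 1 : ℕ) : ℝ) < coupledCuts (n + 1) k ω := (Nat.floor_lt' (by omega)).1 h1
    refine (lt_of_le_of_lt (le_max_left a 0) hy1).trans ?_
    rwa [coupledVar, lt_div_iff₀ (sqrt_succ_pos n)]
  · obtain ⟨y, hy1, hy2⟩ := exists_between hb
    have hy0 : 0 ≤ y := hω.le.trans hy1.le
    have hG : poissonLT k (y ^ 2 / 2) < poissonLT k (ω ^ 2 / 2) :=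
      hanti (Set.mem_Ici.2 hω.le) (Set.mem_Ici.2 hy0) hy1
    filter_upwards [(tendsto_cutTail k hy0).eventually (gt_mem_nhds hG)] with n hn
    have h1 : coupledCuts (n + 1) k ω ≤ ⌊y * √((n + 1 : ℕ) : ℝ)⌋₊ :=
      not_lt.1 fun h => (lt_coupledCuts_iff.1 h).not_gt hn
    have h2 : (coupledCuts (n + 1) k ω : ℝ) ≤ y * √((n + 1 : ℕ) : ℝ) :=
      (Nat.cast_le.2 h1).trans (Nat.floor_le (by positivity))
    refine lt_of_le_of_lt ?_ hy2
    rwa [coupledVar, div_le_iff₀ (sqrt_succ_pos n)]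

lemma coupledVar_nonneg (k n : ℕ) (ω : ℝ) : 0 ≤ coupledVar k n ω := by
  unfold coupledVar; positivity

/-- The exponential tail bound, read through the quantile transform: since the chi tail at `ω` is
at least `exp (-ω ^ 2 / 2)`, the coupled variables are dominated by a quadratic function of `ω`. -/
lemma exists_coupledVar_le (k : ℕ) [NeZero k] :
    ∃ C : ℝ, 0 ≤ C ∧ ∀ᶠ n in atTop, ∀ ω, coupledVar k n ω ≤ C + ω ^ 2 := by
  set K : ℝ := 2 ^ k * Real.exp (2 * (k + 3)) with hK
  have hK0 : 0 < K := by positivity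
  refine ⟨|Real.log K| + 1, by positivity, ?_⟩
  have hev : ∀ᶠ n : ℕ in atTop, ((k : ℝ) + 4) ^ 2 ≤ ((n + 1 : ℕ) : ℝ) :=
    (tendsto_natCast_atTop_atTop.comp (tendsto_add_atTop_nat 1)).eventually_ge_atTop _
  filter_upwards [hev] with n hn ω
  have hs := sqrt_succ_pos n
  have hs1 : 1 ≤ √((n + 1 : ℕ) : ℝ) :=
    Real.one_le_sqrt.2 (by push_cast; linarith [Nat.cast_nonneg (α := ℝ) n])
  rcases Nat.eq_zero_or_pos (coupledCuts (n + 1) k ω) with h0 | h0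
  · rw [coupledVar, h0]
    simp only [CharP.cast_eq_zero, zero_div]
    positivity
  obtain ⟨s, hse⟩ := Nat.exists_eq_succ_of_ne_zero h0.ne'
  have h1 : poissonLT k (ω ^ 2 / 2) < cutTail (n + 1) k s := lt_coupledCuts_iff.1 (by omega)
  have h2 : Real.exp (-(ω ^ 2 / 2)) ≤ poissonLT k (ω ^ 2 / 2) := by
    obtain ⟨q, rfl⟩ : ∃ q, k = q + 1 := Nat.exists_eq_succ_of_ne_zero (NeZero.ne k)
    exact exp_neg_le_poissonLT q (by positivity)
  have h3 := cutTail_le_exp (n := n + 1) (k := k) hn s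
  have h4 : Real.exp (-(ω ^ 2 / 2)) <
      Real.exp (Real.log K + -(s / √((n + 1 : ℕ) : ℝ))) := by
    rw [Real.exp_add, Real.exp_log hK0]
    linarith
  have h5 := Real.exp_lt_exp.1 h4
  have h6 : coupledVar k n ω = s / √((n + 1 : ℕ) : ℝ) + 1 / √((n + 1 : ℕ) : ℝ) := by
    rw [coupledVar, hse, ← add_div]
    push_cast
    rfl
  have h7 : 1 / √((n + 1 : ℕ) : ℝ) ≤ 1 := (div_le_one hs).2 hs1
  rw [h6]
  nlinarith [le_abs_self (Real.log K), sq_nonneg ω]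

lemma memLp_coupledVar [NeZero k] (n : ℕ) (p : ℝ≥0∞) :
    MemLp (coupledVar k n) p (chiMeasure k) := by
  refine MemLp.of_bound (measurable_coupledVar k n).aestronglyMeasurable
    (Fintype.card (Sym2 (Fin (n + 1) ⊕ Fin k)) : ℝ) (Eventually.of_forall fun ω => ?_)
  have h1 : coupledCuts (n + 1) k ω ≤ Fintype.card (Sym2 (Fin (n + 1) ⊕ Fin k)) := by
    refine not_lt.1 fun h => ?_
    have := lt_coupledCuts_iff.1 h
    rw [cutTail_eq_zero] at this
    exact this.not_ge (poissonLT_nonneg k (by positivity))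
  have hs1 : 1 ≤ √((n + 1 : ℕ) : ℝ) :=
    Real.one_le_sqrt.2 (by push_cast; linarith [Nat.cast_nonneg (α := ℝ) n])
  rw [Real.norm_of_nonneg (coupledVar_nonneg _ _ _), coupledVar]
  exact (div_le_self (by positivity) hs1).trans (by exact_mod_cast h1)

lemma memLp_id_chiMeasure [NeZero k] {p : ℝ≥0∞} (hp : p ≠ ∞) :
    MemLp (id : ℝ → ℝ) p (chiMeasure k) := by
  refine ((memLp_sq_chiMeasure hp).add (memLp_const (1 : ℝ))).mono (by fun_prop)
    (Eventually.of_forall fun ω => ?_)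
  simp only [id, Pi.add_apply, Real.norm_eq_abs]
  rw [abs_of_nonneg (by positivity : (0 : ℝ) ≤ ω ^ 2 + 1), abs_le]
  constructor <;> nlinarith [sq_nonneg (ω - 1), sq_nonneg (ω + 1)]

lemma tendsto_eLpNorm_coupledVar [NeZero k] {p : ℝ≥0∞} (hp1 : 1 ≤ p) (hp : p ≠ ∞) :
    Tendsto (fun n => eLpNorm (coupledVar k n - (id : ℝ → ℝ)) p (chiMeasure k)) atTop (𝓝 0) := by
  have hp0 : p ≠ 0 := (zero_lt_one.trans_le hp1).ne'
  have hpr : 0 < p.toReal := ENNReal.toReal_pos hp0 hp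
  obtain ⟨C, hC0, hC⟩ := exists_coupledVar_le k
  set Z : ℝ → ℝ := fun ω => C + 1 + ω ^ 2 + ω ^ 2 with hZ
  have hZp : MemLp Z p (chiMeasure k) :=
    ((memLp_const (C + 1)).add (memLp_sq_chiMeasure hp)).add (memLp_sq_chiMeasure hp)
  have hlim : Tendsto (fun n => ∫⁻ ω, ‖(coupledVar k n - (id : ℝ → ℝ)) ω‖ₑ ^ p.toReal
      ∂chiMeasure k) atTop (𝓝 (∫⁻ _ : ℝ, 0 ∂chiMeasure k)) := by
    refine tendsto_lintegral_filter_of_dominated_convergence (fun ω => ‖Z ω‖ₑ ^ p.toReal)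
      (Eventually.of_forall fun n => ?_) ?_ ?_ ?_
    · exact (((measurable_coupledVar k n).sub measurable_id).enorm.pow_const _)
    · filter_upwards [hC] with n hn
      filter_upwards [ae_chiMeasure_pos (k := k)] with ω hω
      refine ENNReal.rpow_le_rpow ?_ hpr.le
      rw [Real.enorm_eq_ofReal_abs, Real.enorm_eq_ofReal_abs]
      refine ENNReal.ofReal_le_ofReal ?_
      rw [hZ, abs_of_nonneg (by positivity : 0 ≤ C + 1 + ω ^ 2 + ω ^ 2), Pi.sub_apply, id, abs_le]
      have h1 := hn ω
      have h2 := coupledVar_nonneg k n ω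
      constructor <;> nlinarith [sq_nonneg (ω - 1)]
    · exact ((eLpNorm_lt_top_iff_lintegral_rpow_enorm_lt_top hp0 hp).1 hZp.2).ne
    · filter_upwards [ae_chiMeasure_pos (k := k)] with ω hω
      have h1 : Tendsto (fun n => (coupledVar k n - (id : ℝ → ℝ)) ω) atTop (𝓝 0) := by
        simpa using (tendsto_coupledVar (k := k) hω).sub_const ω
      have h2 := (ENNReal.continuous_rpow_const (y := p.toReal)).tendsto _ |>.comp h1.enorm
      simpa [hpr, Function.comp_def] using h2
  rw [lintegral_zero] at hlim
  have h := (ENNReal.continuous_rpow_const (y := 1 / p.toReal)).tendsto _ |>.comp hlim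
  rw [ENNReal.zero_rpow_of_pos (by positivity)] at h
  refine h.congr fun n => ?_
  rw [eLpNorm_eq_lintegral_rpow_enorm_toReal hp0 hp]
  rfl

end Coupling

end CutTree

theorem mainTheorem8 (k : ℕ) [NeZero k] :
    -- convergence in distribution (the size of the tree is `n + 1`, with `n → ∞`)
    TendstoInDistribution (fun n : ℕ => CutTree.normalizedCuts (n + 1) k) atTop (id : ℝ → ℝ)
      (fun n : ℕ => (CutTree.plantedCutting (n + 1) k).toMeasure) (CutTree.chiMeasure k) ∧
    -- convergence in `L^p` on one probability space, for all finite `p ≥ 1` at once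
    ∃ (Ω : Type) (_ : MeasurableSpace Ω) (P : Measure Ω) (_ : IsProbabilityMeasure P)
      (X : ℕ → Ω → ℝ) (Y : Ω → ℝ),
      (∀ n : ℕ, HasLaw (X n)
        ((CutTree.plantedCutting (n + 1) k).toMeasure.map (CutTree.normalizedCuts (n + 1) k)) P) ∧
      HasLaw Y (CutTree.chiMeasure k) P ∧
      ∀ p : ℝ≥0∞, 1 ≤ p → p ≠ ∞ →
        (∀ n : ℕ, MemLp (X n) p P) ∧ MemLp Y p P ∧
        Tendsto (fun n : ℕ => eLpNorm (X n - Y) p P) atTop (𝓝 0) := by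
  refine ⟨?_, ℝ, inferInstance, CutTree.chiMeasure k, inferInstance, CutTree.coupledVar k, id,
    CutTree.hasLaw_coupledVar, HasLaw.id, fun p hp1 hp => ⟨fun n => CutTree.memLp_coupledVar n p,
      CutTree.memLp_id_chiMeasure hp, CutTree.tendsto_eLpNorm_coupledVar hp1 hp⟩⟩
  have h : TendstoInDistribution (CutTree.coupledVar k) atTop (id : ℝ → ℝ)
      (fun _ => CutTree.chiMeasure k) (CutTree.chiMeasure k) := by
    refine tendstoInDistribution_of_ae_tendsto
      (fun n => (CutTree.measurable_coupledVar k n).aemeasurable) aemeasurable_id ?_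
    filter_upwards [CutTree.ae_chiMeasure_pos (k := k)] with ω hω
    exact CutTree.tendsto_coupledVar hω
  refine ⟨fun n => (CutTree.measurable_of_outcome _).aemeasurable, aemeasurable_id, ?_⟩
  refine h.tendsto.congr fun n => ?_
  exact Subtype.ext (CutTree.hasLaw_coupledVar n).map_eq
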